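/- Let $n\ge 2$, let $\mathcal O\subset\mathbb R^n$ be a bounded convex domain (nonempty, open) with $C^\infty$ boundary $\partial\mathcal O$, and let $p,q\in\mathbb R^n\setminus\overline{\mathcal O}$. Let $I=[0,1]$ and $$\mathcal A=\{u\in H^1(I,\mathbb R^n): u(0)=p,\ u(1)=q,\ u(t)\notin\mathcal O \text{ for all } t\in I\},\qquad E(u)=\int_I|u'(t)|^2\,dt,$$ where an element of $H^1(I,\mathbb R^n)$ is identified with its continuous representative. Let $\kappa$ be the maximum, over all points of $\partial\mathcal O$, of the principal curvatures of $\partial\mathcal O$, that is, of the eigenvalues of the differential $d\nu$ of the outward unit normal $\nu$ on the tangent spaces of $\partial\mathcal O$ (this maximum is attained). Then there exists a minimizer of $E$ over $\mathcal A$, and any minimizer $u$ is of class $C^1$ on $I$, with $u'(t)\neq 0$ for all $t\in I$ if $p\ne q$, and has curvature at most $C(\kappa)$, where $C:\mathbb R\to\mathbb R$ is a function that does not depend on $n,\mathcal O,p,q$ or $u$. Here a $C^1$ curve is said to have curvature at most $K$ if its unit tangent $T=u'/|u'|$ is $K$-Lipschitz with respect to arc length: $$|T(t)-T(s)|\le K\int_s^t|u'(r)|\,dr\qquad\text{for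 all } 0\le s\le t\le 1$$ (with $T=0$ where $u'=0$, which concerns only constant curves, in the case $p=q$). -/

import Mathlib

open Set MeasureTheory
open scoped ContDiff

namespace Obstacle

noncomputable section

/-! ### Smooth boundaries and principal curvatures -/

section Boundary

variable {E : Type*} [NormedAddCommGroup E] [InnerProductSpace ℝ E] [CompleteSpace E]

/-- `ρ` is a smooth function on the open neighbourhood `U` of `x`, regular at `x`, and inside `U`
the set `O` is exactly `{ρ < 0}`. -/
structure IsLocalDefiningFunction (O U : Set E) (x : E) (ρ : E → ℝ) : Prop where
  isOpen : IsOpen U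
  mem : x ∈ U
  smooth : ContDiffOn ℝ ∞ ρ U
  regular : gradient ρ x ≠ 0
  eq_sublevel : O ∩ U = {y ∈ U | ρ y < 0}

/-- The boundary of the open set `O` is smooth: near each boundary point, `O` is one side of a
regular smooth hypersurface. -/
def HasSmoothBoundary (O : Set E) : Prop :=
  ∀ x ∈ frontier O, ∃ (U : Set E) (ρ : E → ℝ), IsLocalDefiningFunction O U x ρ

/-- The normalized gradient of `ρ`. If `ρ` is a local defining function of `O`, then on `∂O` this
is the outward unit normal of `O`. -/
def unitNormal (ρ : E → ℝ) (y : E) : E := ‖gradient ρ y‖⁻¹ • gradient ρ y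

/-- `k` is a principal curvature of `∂O` at the boundary point `x`: an eigenvalue of the Weingarten
map `v ↦ dν(v)` on the tangent space `(∇ρ x)ᗮ` of `∂O` at `x`, where `ν` is the outward unit
normal. With this sign, the principal curvatures of the sphere of radius `r` bounding a ball are
`1 / r`, and those of the boundary of a convex set are nonnegative. -/
def IsPrincipalCurvatureAt (O : Set E) (x : E) (k : ℝ) : Prop :=
  ∃ (U : Set E) (ρ : E → ℝ), IsLocalDefiningFunction O U x ρ ∧
    ∃ v : E, v ≠ 0 ∧ inner ℝ (gradient ρ x) v = 0 ∧ fderiv ℝ (unitNormal ρ) x v = k • v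

/-- The set of all principal curvatures of `∂O`, at all boundary points. -/
def principalCurvatures (O : Set E) : Set ℝ :=
  {k | ∃ x ∈ frontier O, IsPrincipalCurvatureAt O x k}

/-- The maximum principal curvature of `∂O`. -/
def maxPrincipalCurvature (O : Set E) : ℝ := sSup (principalCurvatures O)

end Boundary

/-! ### The energy on `H¹(I, E)`, `I = [0, 1]`

A curve is a function `u : ℝ → E`, of which only the values on `I` are ever used. -/

section Energy

variable {E : Type*} [NormedAddCommGroup E] [NormedSpace ℝ E]

/-- `g` is a square-integrable weak derivative of `u` on the unit interval. -/
def IsWeakDeriv (u g : ℝ → E) : Prop :=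
  MemLp g 2 (volume.restrict (Icc (0 : ℝ) 1)) ∧
    ∀ φ : ℝ → ℝ, ContDiff ℝ ∞ φ → HasCompactSupport φ → tsupport φ ⊆ Ioo 0 1 →
      ∫ t in Icc (0 : ℝ) 1, deriv φ t • u t = -∫ t in Icc (0 : ℝ) 1, φ t • g t

/-- `u` belongs to the Sobolev space `H¹(I, E)`. -/
def MemH1 (u : ℝ → E) : Prop :=
  MemLp u 2 (volume.restrict (Icc (0 : ℝ) 1)) ∧ ∃ g, IsWeakDeriv u g

/-- The weak derivative of `u`, unique up to null sets (a junk function if there is none). -/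
def weakDeriv (u : ℝ → E) : ℝ → E := Classical.epsilon (IsWeakDeriv u)

/-- The Dirichlet energy `∫_I |u'|²` of an `H¹` curve. -/
def energy (u : ℝ → E) : ℝ := ∫ t in Icc (0 : ℝ) 1, ‖weakDeriv u t‖ ^ 2

/-- The `H¹` curves (by their continuous representatives) from `p` to `q` that stay outside `O`. -/
def admissible (O : Set E) (p q : E) : Set (ℝ → E) :=
  {u | MemH1 u ∧ ContinuousOn u (Icc 0 1) ∧ u 0 = p ∧ u 1 = q ∧ ∀ t ∈ Icc (0 : ℝ) 1, u t ∉ O}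

/-- `u` minimizes the Dirichlet energy among the admissible curves. -/
def IsMinimizer (O : Set E) (p q : E) (u : ℝ → E) : Prop :=
  u ∈ admissible O p q ∧ ∀ v ∈ admissible O p q, energy u ≤ energy v

/-! ### Curvature bounds for `C¹` curves -/

/-- The classical velocity on `I`, one-sided at the endpoints. -/
def velocity (u : ℝ → E) (t : ℝ) : E := derivWithin u (Icc 0 1) t

/-- The unit tangent of a `C¹` curve (`0` where the velocity vanishes). -/
def unitTangent (u : ℝ → E) (t : ℝ) : E := ‖velocity u t‖⁻¹ • velocity u t

/-- The `C¹` curve `u` has curvature at most `K`: its unit tangent is `K`-Lipschitz as a function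
of arc length. Equivalently, the arc length parametrization is `C^{1,1}` and its second derivative,
which exists almost everywhere, has norm at most `K`. -/
def HasCurvatureAtMost (u : ℝ → E) (K : ℝ) : Prop :=
  ∀ s ∈ Icc (0 : ℝ) 1, ∀ t ∈ Icc (0 : ℝ) 1, s ≤ t →
    ‖unitTangent u t - unitTangent u s‖ ≤ K * ∫ r in s..t, ‖velocity u r‖

end Energy

end

end Obstacle

/-! Existence. Reparametrizing by arc length turns an `H¹` curve into an `ℓ`-Lipschitz one with `ℓ²
≤ E` (Cauchy–Schwarz), and an `ℓ`-Lipschitz curve has energy at most `ℓ²`. So minimizing the energy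
amounts to minimizing the Lipschitz constant, and Tychonoff compactness applies. Competitors exist
because in dimension at least 2 one can walk around a bounded convex set.

Regularity. Equality in Cauchy–Schwarz makes a minimizer `u` an `ℓ`-Lipschitz curve of energy `ℓ²`.
Split it as `u = x + d n`, with `x` its projection to `∂O`, `d` its distance to `O` and `n` the
outer normal at `x`. By convexity a perturbed curve avoids `O` as soon as it stays in the supporting
half-spaces `⟨y - x, n⟩ ≥ 0`. For a test field `η`, the variation `θ ⟨η, n⟩⁺ n - η` has this
property for small steps, where `θ` is a cutoff equal to 1 on the contact set `d = 0`. Let `θ`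
shrink to the indicator of that set: there `d' = 0` and `u' = x'`, so the first variation leaves `∫
⟨u', η'⟩ ≤ ∫ ⟨x', n'⟩ |η| ≤ |κ| ℓ² ∫ |η|` over the contact set (`integral_inner_deriv_le`). Hence
`u'` is `|κ| ℓ²`-Lipschitz in time, and since the speed is `ℓ`, the curvature is at most `|κ|`; so
`C κ = |κ|`.

Only Lipschitz regularity of `x`, `n` and `d` is used, with derivatives almost everywhere: the
projection is 1-Lipschitz, and the Gauss map is Lipschitz on the compact smooth boundary.

The maximal curvature. The second fundamental form is continuous on the compact unit tangent bundle
of `∂O`; since the Weingarten map is symmetric, a maximizer is an eigenvector, so the maximum is a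
principal curvature and bounds the form everywhere. -/

set_option linter.unusedSectionVars false

namespace Obstacle

open Filter Topology NNReal

/-! ### Absolutely continuous curves, weak derivatives and constant-speed reparametrization -/

section Calculus

variable {E : Type*} [NormedAddCommGroup E] [InnerProductSpace ℝ E] [FiniteDimensional ℝ E]

theorem absolutelyContinuousOnInterval_comp {X Y : Type*} [PseudoMetricSpace X]
    [PseudoMetricSpace Y] {K : ℝ≥0} {φ : X → Y} (hφ : LipschitzWith K φ) {f : ℝ → X} {a b : ℝ}
    (hf : AbsolutelyContinuousOnInterval f a b) :
    AbsolutelyContinuousOnInterval (fun t => φ (f t)) a b := by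
  unfold AbsolutelyContinuousOnInterval at hf ⊢
  refine squeeze_zero (fun t => Finset.sum_nonneg fun i _ => dist_nonneg) (fun t => ?_)
    (by simpa using hf.const_mul (K : ℝ))
  rw [Finset.mul_sum]
  exact Finset.sum_le_sum fun i _ => hφ.dist_le_mul _ _

/-- The fundamental theorem of calculus for absolutely continuous vector-valued functions. -/
theorem integral_eq_sub_of_absolutelyContinuous {f f' : ℝ → E} {a b : ℝ}
    (hf : AbsolutelyContinuousOnInterval f a b) (hf' : IntervalIntegrable f' volume a b)
    (hd : ∀ᵐ x, x ∈ uIcc a b → HasDerivAt f (f' x) x) :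
    ∫ x in a..b, f' x = f b - f a := by
  have := FiniteDimensional.complete ℝ E
  refine ext_inner_left ℝ fun e => ?_
  have h1 : ∫ x in a..b, inner ℝ e (f' x) = inner ℝ e (∫ x in a..b, f' x) :=
    (innerSL ℝ e).intervalIntegral_comp_comm hf'
  rw [← h1, inner_sub_right]
  have hac : AbsolutelyContinuousOnInterval (fun t => inner ℝ e (f t)) a b :=
    absolutelyContinuousOnInterval_comp (innerSL ℝ e).lipschitz hf
  rw [← hac.integral_deriv_eq_sub]
  refine intervalIntegral.integral_congr_ae ?_
  filter_upwards [hd] with x hx hxab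
  have := (innerSL ℝ e).hasFDerivAt.comp_hasDerivAt x (hx (uIoc_subset_uIcc hxab))
  exact this.deriv.symm

theorem memLp_deriv_of_lipschitz {K : ℝ≥0} {f : ℝ → E} (hf : LipschitzWith K f) {s : Set ℝ}
    (hs : volume s ≠ ⊤) (p : ENNReal) : MemLp (deriv f) p (volume.restrict s) := by
  have : IsFiniteMeasure (volume.restrict s) := ⟨by simpa using hs.lt_top⟩
  have := FiniteDimensional.complete ℝ E
  exact MemLp.of_bound (stronglyMeasurable_deriv f).aestronglyMeasurable K
    (ae_of_all _ fun x => norm_deriv_le_of_lipschitz hf)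

theorem intervalIntegrable_deriv_of_lipschitz {K : ℝ≥0} {f : ℝ → E} (hf : LipschitzWith K f)
    (a b : ℝ) : IntervalIntegrable (deriv f) volume a b := by
  rw [intervalIntegrable_iff, IntegrableOn, ← memLp_one_iff_integrable]
  exact memLp_deriv_of_lipschitz hf (by simp [uIoc]) 1

theorem integral_deriv_of_lipschitz {K : ℝ≥0} {f : ℝ → E} (hf : LipschitzWith K f)
    (a b : ℝ) : ∫ x in a..b, deriv f x = f b - f a := by
  refine integral_eq_sub_of_absolutelyContinuous hf.lipschitzOnWith.absolutelyContinuousOnInterval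
    (intervalIntegrable_deriv_of_lipschitz hf a b) ?_
  filter_upwards [hf.ae_differentiableAt] with x hx _ using hx.hasDerivAt

/-! ### Weak derivatives -/

theorem IsWeakDeriv.congr {u v g : ℝ → E} (h : IsWeakDeriv u g) (huv : EqOn u v (Icc 0 1)) :
    IsWeakDeriv v g := by
  refine ⟨h.1, fun φ h1 h2 h3 => ?_⟩
  rw [← h.2 φ h1 h2 h3]
  exact setIntegral_congr_fun measurableSet_Icc fun t ht => by simp only [huv ht]

/-- The increments of the primitive of `g` are dominated by those of the primitive of `‖g‖`, which
reduces the claim to the scalar case. -/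
theorem absolutelyContinuousOnInterval_integral {g : ℝ → E} {a b : ℝ}
    (hg : IntervalIntegrable g volume a b) :
    AbsolutelyContinuousOnInterval (fun t => ∫ s in a..t, g s) a b := by
  have h := hg.norm.absolutelyContinuousOnInterval_intervalIntegral (c := a) left_mem_uIcc
  unfold AbsolutelyContinuousOnInterval at h ⊢
  refine squeeze_zero' (Eventually.of_forall fun t => Finset.sum_nonneg fun i _ => dist_nonneg)
    ?_ h
  filter_upwards [mem_inf_of_right (mem_principal_self _)] with F hF
  refine Finset.sum_le_sum fun i hi => ?_
  obtain ⟨h1, h2⟩ := hF.1 i hi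
  have j : ∀ x ∈ uIcc a b, IntervalIntegrable g volume a x := fun x hx =>
    hg.mono_set (uIcc_subset_uIcc_left hx)
  rw [dist_eq_norm, dist_eq_norm,
    intervalIntegral.integral_interval_sub_left (j _ h1) (j _ h2),
    intervalIntegral.integral_interval_sub_left (j _ h1).norm (j _ h2).norm, Real.norm_eq_abs]
  exact intervalIntegral.norm_integral_le_abs_integral_norm

/-- Integration by parts against a test function. -/
theorem integral_deriv_smul_eq_neg {v v' : ℝ → E} (hv : AbsolutelyContinuousOnInterval v 0 1)
    (hv' : IntervalIntegrable v' volume 0 1)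
    (hd : ∀ᵐ t, t ∈ uIcc (0 : ℝ) 1 → HasDerivAt v (v' t) t) {φ : ℝ → ℝ} (h1 : ContDiff ℝ ∞ φ)
    (h3 : tsupport φ ⊆ Ioo 0 1) :
    ∫ t in Icc (0 : ℝ) 1, deriv φ t • v t = -∫ t in Icc (0 : ℝ) 1, φ t • v' t := by
  have hφ0 : φ 0 = 0 := image_eq_zero_of_notMem_tsupport fun h => by simpa using (h3 h).1
  have hφ1 : φ 1 = 0 := image_eq_zero_of_notMem_tsupport fun h => by simpa using (h3 h).2
  have hd1 : Continuous (deriv φ) := h1.continuous_deriv (by simp)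
  have hφd : Differentiable ℝ φ := h1.differentiable (by simp)
  have hac : AbsolutelyContinuousOnInterval (fun t => φ t • v t) 0 1 :=
    ((h1.of_le (by simp)).contDiffOn.absolutelyContinuousOnInterval).fun_smul hv
  have i1 : IntervalIntegrable (fun t => deriv φ t • v t) volume 0 1 :=
    (hd1.continuousOn.smul hv.continuousOn).intervalIntegrable
  have i2 : IntervalIntegrable (fun t => φ t • v' t) volume 0 1 :=
    hv'.continuousOn_smul h1.continuous.continuousOn
  have := integral_eq_sub_of_absolutelyContinuous hac (i2.add i1) (by
    filter_upwards [hd] with x hx hx'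
    exact (hφd x).hasDerivAt.smul (hx hx'))
  rw [intervalIntegral.integral_add i2 i1, hφ0, hφ1] at this
  rw [integral_Icc_eq_integral_Ioc, integral_Icc_eq_integral_Ioc,
    ← intervalIntegral.integral_of_le zero_le_one, ← intervalIntegral.integral_of_le zero_le_one]
  rw [add_comm] at this
  exact eq_neg_of_add_eq_zero_left (by simpa using this)

theorem isWeakDeriv_deriv_of_lipschitz {K : ℝ≥0} {v : ℝ → E} (hv : LipschitzWith K v) :
    IsWeakDeriv v (deriv v) := by
  refine ⟨memLp_deriv_of_lipschitz hv (by simp) 2, fun φ h1 _ h3 => ?_⟩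
  refine integral_deriv_smul_eq_neg hv.lipschitzOnWith.absolutelyContinuousOnInterval
    (intervalIntegrable_deriv_of_lipschitz hv 0 1) ?_ h1 h3
  filter_upwards [hv.ae_differentiableAt] with x hx _ using hx.hasDerivAt

/-- The fundamental lemma of the calculus of variations. It frees `energy` from the arbitrary choice
made in `weakDeriv`. -/
theorem IsWeakDeriv.ae_unique {u g g' : ℝ → E} (h : IsWeakDeriv u g) (h' : IsWeakDeriv u g') :
    g =ᵐ[volume.restrict (Icc (0 : ℝ) 1)] g' := by
  have := FiniteDimensional.complete ℝ E
  have hi : IntegrableOn g (Icc 0 1) := h.1.integrable (by simp)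
  have hi' : IntegrableOn g' (Icc 0 1) := h'.1.integrable (by simp)
  have key : ∀ᵐ x, x ∈ Ioo (0 : ℝ) 1 → (g - g') x = 0 := by
    refine isOpen_Ioo.ae_eq_zero_of_integral_contDiff_smul_eq_zero
      ((hi.sub hi').mono_set Ioo_subset_Icc_self).locallyIntegrableOn fun φ h1 h2 h3 => ?_
    have e1 := h.2 φ h1 h2 h3
    rw [h'.2 φ h1 h2 h3, neg_inj] at e1
    obtain ⟨C, hC⟩ := h2.exists_bound_of_continuous h1.continuous
    have j : ∀ {f : ℝ → E}, IntegrableOn f (Icc 0 1) →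
        IntegrableOn (fun t => φ t • f t) (Icc 0 1) := fun hf =>
      hf.bdd_smul C h1.continuous.aestronglyMeasurable (ae_of_all _ hC)
    have e2 : ∫ t in Icc (0 : ℝ) 1, φ t • (g - g') t = 0 := by
      simp only [Pi.sub_apply, smul_sub]
      rw [integral_sub (j hi) (j hi'), e1, sub_self]
    rw [← e2]
    refine (setIntegral_eq_integral_of_forall_compl_eq_zero fun x hx => ?_).symm
    rw [image_eq_zero_of_notMem_tsupport fun hx' => hx (Ioo_subset_Icc_self (h3 hx')), zero_smul]
  have key' : ∀ᵐ x ∂(volume.restrict (Ioo (0 : ℝ) 1)), g x = g' x := by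
    rw [ae_restrict_iff' measurableSet_Ioo]
    filter_upwards [key] with x hx hxI using sub_eq_zero.1 (hx hxI)
  rwa [restrict_Ioo_eq_restrict_Icc] at key'

theorem MemH1.isWeakDeriv_weakDeriv {u : ℝ → E} (h : MemH1 u) : IsWeakDeriv u (weakDeriv u) :=
  Classical.epsilon_spec h.2

theorem IsWeakDeriv.energy_eq {u g : ℝ → E} (h : IsWeakDeriv u g) :
    energy u = ∫ t in (0 : ℝ)..1, ‖g t‖ ^ 2 := by
  have := (Classical.epsilon_spec (p := IsWeakDeriv u) ⟨g, h⟩).ae_unique h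
  rw [energy, intervalIntegral.integral_of_le zero_le_one, ← integral_Icc_eq_integral_Ioc]
  refine integral_congr_ae ?_
  filter_upwards [this] with t ht
  rw [weakDeriv, ht]

theorem memH1_of_lipschitz {K : ℝ≥0} {v : ℝ → E} (hv : LipschitzWith K v) : MemH1 v :=
  have ⟨C, hC⟩ := isCompact_Icc.exists_bound_of_continuousOn
    (hv.continuous.continuousOn (s := Icc (0 : ℝ) 1))
  ⟨MemLp.of_bound hv.continuous.aestronglyMeasurable C
    ((ae_restrict_iff' measurableSet_Icc).2 (ae_of_all _ hC)), _, isWeakDeriv_deriv_of_lipschitz hv⟩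

theorem IsWeakDeriv.intervalIntegrable {u g : ℝ → E} (h : IsWeakDeriv u g) {a b : ℝ}
    (ha : a ∈ Icc (0 : ℝ) 1) (hb : b ∈ Icc (0 : ℝ) 1) : IntervalIntegrable g volume a b := by
  have hi : IntegrableOn g (Icc 0 1) := h.1.integrable (by simp)
  exact (hi.mono_set (uIcc_subset_Icc ha hb)).intervalIntegrable

/-- The du Bois-Reymond lemma. -/
theorem eqOn_const_of_integral_deriv_smul_eq_zero {w : ℝ → E} (hw : ContinuousOn w (Icc 0 1))
    (h : ∀ φ : ℝ → ℝ, ContDiff ℝ ∞ φ → HasCompactSupport φ → tsupport φ ⊆ Ioo 0 1 →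
      ∫ t in Icc (0 : ℝ) 1, deriv φ t • w t = 0) : ∃ c, EqOn w (fun _ => c) (Icc 0 1) := by
  have := FiniteDimensional.complete ℝ E
  have hwi : IntegrableOn w (Icc 0 1) := hw.integrableOn_Icc
  -- A bump of mass one supported in `[1/4, 3/4]`; the constant will be the average of `w` against
  -- it.
  let B : ContDiffBump (1 / 2 : ℝ) := ⟨1 / 8, 1 / 4, by norm_num, by norm_num⟩
  let ψ : ℝ → ℝ := B.normed volume
  have hψ : ContDiff ℝ ∞ ψ := B.contDiff_normed
  have hψt : tsupport ψ = Metric.closedBall (1 / 2) (1 / 4) := B.tsupport_normed_eq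
  have hψi : ∫ t, ψ t = 1 := B.integral_normed
  let c : E := ∫ t in Icc (0 : ℝ) 1, ψ t • w t
  refine ⟨c, ?_⟩
  have hint : ∀ {φ : ℝ → ℝ}, Continuous φ → IntegrableOn (fun t => φ t • w t) (Icc 0 1) :=
    fun hφ => (hφ.continuousOn.smul hw).integrableOn_Icc
  have key : ∀ᵐ x, x ∈ Ioo (0 : ℝ) 1 → (w x - c) = 0 := by
    refine isOpen_Ioo.ae_eq_zero_of_integral_contDiff_smul_eq_zero
      ((hwi.sub (by simp)).mono_set Ioo_subset_Icc_self).locallyIntegrableOn fun η h1 h2 h3 => ?_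
    let m : ℝ := ∫ t, η t
    -- Subtracting `m ψ` gives mean zero, so the primitive of `f` is again compactly supported in
    -- `(0, 1)` and may be used as a test function.
    let f : ℝ → ℝ := fun t => η t - m * ψ t
    have hf : ContDiff ℝ ∞ f := h1.sub (contDiff_const.mul hψ)
    let φ : ℝ → ℝ := fun t => ∫ s in (0 : ℝ)..t, f s
    have hφd : deriv φ = f := funext fun t => hf.continuous.deriv_integral f 0 t
    have hφ : ContDiff ℝ ∞ φ := by
      refine contDiff_infty_iff_deriv.2 ⟨fun t => ?_, hφd ▸ hf⟩
      exact (hf.continuous.integral_hasStrictDerivAt 0 t).hasDerivAt.differentiableAt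
    have hKc : IsCompact (tsupport η ∪ tsupport ψ) :=
      h2.isCompact.union (hψt ▸ isCompact_closedBall _ _)
    have hKn : (tsupport η ∪ tsupport ψ).Nonempty :=
      ⟨1 / 2, Or.inr (by rw [hψt]; simp)⟩
    have hKs : tsupport η ∪ tsupport ψ ⊆ Ioo 0 1 := by
      refine union_subset h3 ?_
      rw [hψt, Real.closedBall_eq_Icc]
      exact Icc_subset_Ioo (by norm_num) (by norm_num)
    obtain ⟨a, haK, ha⟩ := hKc.exists_isLeast hKn
    obtain ⟨b, hbK, hb⟩ := hKc.exists_isGreatest hKn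
    have hfs : ∀ t, t ∉ Icc a b → f t = 0 := fun t ht => by
      have : t ∉ tsupport η ∪ tsupport ψ := fun h' => ht ⟨ha h', hb h'⟩
      rw [mem_union, not_or] at this
      simp [f, image_eq_zero_of_notMem_tsupport this.1, image_eq_zero_of_notMem_tsupport this.2]
    have hφs : tsupport φ ⊆ Icc a b := by
      refine closure_minimal (fun t ht => ?_) isClosed_Icc
      by_contra htI
      refine ht ?_
      rcases lt_or_ge t a with hta | hta
      · refine (intervalIntegral.integral_congr fun x hx => hfs x fun hx' => ?_).trans
          intervalIntegral.integral_zero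
        have h5 : x ≤ max 0 t := hx.2
        have := (hKs haK).1
        rcases le_max_iff.1 h5 with h6 | h6 <;> linarith [hx'.1]
      · have htb : b < t := lt_of_not_ge fun hb' => htI ⟨hta, hb'⟩
        have : ∫ s in (0 : ℝ)..t, f s = ∫ s, f s := by
          refine intervalIntegral.integral_eq_integral_of_support_subset fun x hx => ?_
          have hx' : x ∈ Icc a b := by_contra fun h' => hx (hfs x h')
          exact ⟨(hKs haK).1.trans_le hx'.1, hx'.2.trans htb.le⟩
        change ∫ s in (0 : ℝ)..t, f s = 0
        rw [this, integral_sub (h1.continuous.integrable_of_hasCompactSupport h2)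
          ((hψ.continuous.integrable_of_hasCompactSupport
            (hψt ▸ isCompact_closedBall _ _ : IsCompact (tsupport ψ))).const_mul m),
          integral_const_mul, hψi, mul_one, sub_self]
    have e1 := h φ hφ (isCompact_Icc.of_isClosed_subset (isClosed_tsupport _) hφs)
      (hφs.trans (Icc_subset_Ioo (hKs haK).1 (hKs hbK).2))
    rw [hφd] at e1
    have e2 : ∀ t, f t • w t = η t • w t - m • (ψ t • w t) := fun t => by
      simp only [f, sub_smul, mul_smul]
    simp only [e2] at e1
    have e5 : IntegrableOn (fun t => m • ψ t • w t) (Icc 0 1) volume :=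
      (hint hψ.continuous).fun_smul m
    rw [integral_sub (hint h1.continuous) e5, integral_smul] at e1
    have e3 : ∫ t in Icc (0 : ℝ) 1, η t • c = m • c := by
      rw [integral_smul_const, setIntegral_eq_integral_of_forall_compl_eq_zero fun x hx =>
        image_eq_zero_of_notMem_tsupport fun hx' => hx (Ioo_subset_Icc_self (h3 hx'))]
    have e4 : ∫ t in Icc (0 : ℝ) 1, η t • (w t - c) = 0 := by
      simp only [smul_sub]
      rw [integral_sub (hint h1.continuous)
        (h1.continuous.fun_smul continuous_const).continuousOn.integrableOn_Icc, e3]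
      exact e1
    rw [← e4]
    refine (setIntegral_eq_integral_of_forall_compl_eq_zero fun x hx => ?_).symm
    rw [image_eq_zero_of_notMem_tsupport fun hx' => hx (Ioo_subset_Icc_self (h3 hx')), zero_smul]
  refine Measure.eqOn_Icc_of_ae_eq volume zero_ne_one ?_ hw continuousOn_const
  rw [← restrict_Ioo_eq_restrict_Icc]
  refine (ae_restrict_iff' measurableSet_Ioo).2 ?_
  filter_upwards [key] with x hx hxI using sub_eq_zero.1 (hx hxI)

/-- The difference of `u` and the primitive of `g` has weak derivative zero, so it is constant by du
Bois-Reymond. -/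
theorem IsWeakDeriv.eq_add_integral {u g : ℝ → E} (h : IsWeakDeriv u g)
    (hc : ContinuousOn u (Icc 0 1)) {t : ℝ} (ht : t ∈ Icc (0 : ℝ) 1) :
    u t = u 0 + ∫ s in (0 : ℝ)..t, g s := by
  have hgi : IntervalIntegrable g volume 0 1 := h.intervalIntegrable (by simp) (by simp)
  have hac := absolutelyContinuousOnInterval_integral hgi
  have hGc : ContinuousOn (fun t => ∫ s in (0 : ℝ)..t, g s) (Icc 0 1) := by
    simpa [uIcc_of_le] using hac.continuousOn
  obtain ⟨c, hcc⟩ := eqOn_const_of_integral_deriv_smul_eq_zero (hc.fun_sub hGc)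
    fun φ h1 h2 h3 => by
      have hd : Continuous (deriv φ) := h1.continuous_deriv (by simp)
      simp only [smul_sub]
      rw [integral_sub (hd.continuousOn.fun_smul hc).integrableOn_Icc
        (hd.continuousOn.fun_smul hGc).integrableOn_Icc, h.2 φ h1 h2 h3,
        integral_deriv_smul_eq_neg hac hgi ?_ h1 h3, sub_self]
      filter_upwards [hgi.ae_hasDerivAt_integral] with x hx hx' using hx hx' 0 (by simp)
  have h0 := hcc (left_mem_Icc.2 zero_le_one)
  have h1 := hcc ht
  simp only [intervalIntegral.integral_same, sub_zero] at h0 h1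
  rw [h0, ← h1, sub_add_cancel]

theorem energy_le_of_lipschitz {K : ℝ≥0} {v : ℝ → E} (hv : LipschitzWith K v) :
    energy v ≤ K ^ 2 := by
  rw [(isWeakDeriv_deriv_of_lipschitz hv).energy_eq]
  have : ∀ x ∈ uIoc (0 : ℝ) 1, ‖‖deriv v x‖ ^ 2‖ ≤ (K : ℝ) ^ 2 := fun x _ => by
    rw [Real.norm_of_nonneg (by positivity)]
    exact pow_le_pow_left₀ (norm_nonneg _) (norm_deriv_le_of_lipschitz hv) 2
  refine (Real.le_norm_self _).trans
    ((intervalIntegral.norm_integral_le_of_norm_le_const this).trans (by simp))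

/-- Every `H¹` curve can be reparametrized with constant speed, which does not increase its energy;
an energy-minimizing parametrization has constant speed. -/
theorem exists_lipschitz_reparam {u : ℝ → E} (hu : MemH1 u) (hc : ContinuousOn u (Icc 0 1)) :
    ∃ (ℓ : ℝ≥0) (v : ℝ → E), LipschitzWith ℓ v ∧ v 0 = u 0 ∧ v 1 = u 1 ∧
      (∀ t, v t ∈ u '' Icc 0 1) ∧ (ℓ : ℝ) ^ 2 ≤ energy u ∧
      (energy u ≤ (ℓ : ℝ) ^ 2 → LipschitzOnWith ℓ u (Icc 0 1)) := by
  obtain ⟨g, hg⟩ := hu.2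
  have hgi : ∀ {a b : ℝ}, a ∈ Icc (0 : ℝ) 1 → b ∈ Icc (0 : ℝ) 1 → IntervalIntegrable g volume a b :=
    fun ha hb => hg.intervalIntegrable ha hb
  have I0 : (0 : ℝ) ∈ Icc (0 : ℝ) 1 := by simp
  have I1 : (1 : ℝ) ∈ Icc (0 : ℝ) 1 := by simp
  have hsub : ∀ {a b : ℝ}, a ∈ Icc (0 : ℝ) 1 → b ∈ Icc (0 : ℝ) 1 →
      u a - u b = ∫ s in b..a, g s := fun ha hb => by
    rw [hg.eq_add_integral hc ha, hg.eq_add_integral hc hb, add_sub_add_left_eq_sub,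
      intervalIntegral.integral_interval_sub_left (hgi I0 ha) (hgi I0 hb)]
  let s : ℝ → ℝ := fun t => ∫ r in (0 : ℝ)..t, ‖g r‖
  have hs : ∀ {a b : ℝ}, a ∈ Icc (0 : ℝ) 1 → b ∈ Icc (0 : ℝ) 1 → ‖u a - u b‖ ≤ |s a - s b| :=
    fun ha hb => by
    rw [hsub ha hb, intervalIntegral.integral_interval_sub_left (hgi I0 ha).norm (hgi I0 hb).norm]
    exact intervalIntegral.norm_integral_le_abs_integral_norm
  have hs0 : s 0 = 0 := intervalIntegral.integral_same
  have hs1 : 0 ≤ s 1 := intervalIntegral.integral_nonneg zero_le_one fun _ _ => norm_nonneg _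
  have hsc : ContinuousOn s (Icc 0 1) := by
    have := ((hgi I0 I1).norm.absolutelyContinuousOnInterval_intervalIntegral
      (c := 0) left_mem_uIcc).continuousOn
    rwa [uIcc_of_le zero_le_one] at this
  -- The arc length `s` need not be injective; any right inverse serves, since by `hs` the curve is
  -- constant wherever `s` is.
  have hτ : ∀ r : ℝ, ∃ τ ∈ Icc (0 : ℝ) 1, s τ = s 1 * projIcc (0 : ℝ) 1 zero_le_one r := fun r => by
    have hmem := (projIcc (0 : ℝ) 1 zero_le_one r).2
    refine intermediate_value_Icc zero_le_one hsc ⟨?_, ?_⟩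
    · rw [hs0]; exact mul_nonneg hs1 hmem.1
    · exact mul_le_of_le_one_right hs1 hmem.2
  choose τ hτI hτs using hτ
  have hEl : energy u = ∫ t in (0 : ℝ)..1, ‖g t‖ ^ 2 := hg.energy_eq
  have hsqi : IntervalIntegrable (fun t => ‖g t‖ ^ 2) volume 0 1 := by
    rw [intervalIntegrable_iff_integrableOn_Icc_of_le zero_le_one]
    exact (memLp_two_iff_integrable_sq_norm hg.1.1).1 hg.1
  -- The variance of the speed: its nonnegativity is Cauchy–Schwarz, and its vanishing forces
  -- constant speed.
  have hvar : ∫ t in (0 : ℝ)..1, (‖g t‖ - s 1) ^ 2 = energy u - s 1 ^ 2 := by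
    have : ∀ t, (‖g t‖ - s 1) ^ 2 = ‖g t‖ ^ 2 - 2 * s 1 * ‖g t‖ + s 1 ^ 2 := fun t => by ring
    simp only [this]
    rw [intervalIntegral.integral_add (hsqi.sub ((hgi I0 I1).norm.const_mul _)) (by simp),
      intervalIntegral.integral_sub hsqi ((hgi I0 I1).norm.const_mul _),
      intervalIntegral.integral_const_mul, hEl]
    change _ - 2 * s 1 * s 1 + _ = _
    simp
    ring
  have hvar0 : 0 ≤ ∫ t in (0 : ℝ)..1, (‖g t‖ - s 1) ^ 2 :=
    intervalIntegral.integral_nonneg zero_le_one fun _ _ => sq_nonneg _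
  refine ⟨⟨s 1, hs1⟩, fun r => u (τ r), ?_, ?_, ?_, fun t => ⟨_, hτI t, rfl⟩, ?_, fun hE => ?_⟩
  · refine LipschitzWith.of_dist_le_mul fun a b => ?_
    rw [dist_eq_norm]
    refine (hs (hτI a) (hτI b)).trans ?_
    rw [hτs, hτs, ← mul_sub, abs_mul, abs_of_nonneg hs1]
    refine mul_le_mul_of_nonneg_left ?_ hs1
    simpa [Real.dist_eq, Subtype.dist_eq] using
      (LipschitzWith.projIcc (zero_le_one (α := ℝ))).dist_le_mul a b
  · refine sub_eq_zero.1 (norm_le_zero_iff.1 ((hs (hτI 0) I0).trans ?_))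
    simp [hτs, hs0]
  · refine sub_eq_zero.1 (norm_le_zero_iff.1 ((hs (hτI 1) I1).trans ?_))
    simp [hτs]
  · change s 1 ^ 2 ≤ energy u
    linarith
  · change energy u ≤ s 1 ^ 2 at hE
    have hz : ∫ t in (0 : ℝ)..1, (‖g t‖ - s 1) ^ 2 = 0 := by linarith
    have hvi : IntervalIntegrable (fun t => (‖g t‖ - s 1) ^ 2) volume 0 1 := by
      have : (fun t => (‖g t‖ - s 1) ^ 2) = fun t => ‖g t‖ ^ 2 - 2 * s 1 * ‖g t‖ + s 1 ^ 2 := by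
        ext t; ring
      rw [this]
      exact (hsqi.sub ((hgi I0 I1).norm.const_mul _)).add (by simp)
    have hae := (intervalIntegral.integral_eq_zero_iff_of_le_of_nonneg_ae zero_le_one
      (ae_of_all _ fun t => sq_nonneg _) hvi).1 hz
    have hae' : ∀ᵐ t, t ∈ Ioc (0 : ℝ) 1 → ‖g t‖ ≤ s 1 := by
      rw [← ae_restrict_iff' measurableSet_Ioc]
      filter_upwards [hae] with t ht
      have : ‖g t‖ - s 1 = 0 := by simpa using ht
      linarith
    refine LipschitzOnWith.of_dist_le_mul fun a ha b hb => ?_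
    rw [dist_eq_norm, hsub ha hb, Real.dist_eq]
    refine intervalIntegral.norm_integral_le_of_norm_le_const_ae ?_
    filter_upwards [hae'] with t ht htI
    exact ht ⟨(le_min hb.1 ha.1).trans_lt htI.1, htI.2.trans (max_le hb.2 ha.2)⟩

end Calculus

/-! ### Existence of minimizers -/

section Existence

variable {E : Type*} [NormedAddCommGroup E] [InnerProductSpace ℝ E] [FiniteDimensional ℝ E]

/-- The `K`-Lipschitz curves (defined on all of `ℝ`) from `p` to `q` that avoid `O`. -/
def lipschitzCurves (O : Set E) (p q : E) (K : ℝ≥0) : Set (ℝ → E) :=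
  {v | LipschitzWith K v ∧ v 0 = p ∧ v 1 = q ∧ ∀ t, v t ∉ O}

theorem mem_admissible_of_mem_lipschitzCurves {O : Set E} {p q : E} {K : ℝ≥0} {v : ℝ → E}
    (hv : v ∈ lipschitzCurves O p q K) : v ∈ admissible O p q :=
  ⟨memH1_of_lipschitz hv.1, hv.1.continuous.continuousOn, hv.2.1, hv.2.2.1, fun t _ => hv.2.2.2 t⟩

theorem lipschitzCurves_mono {O : Set E} {p q : E} : Monotone (lipschitzCurves O p q) :=
  fun _ _ h _ hv => ⟨hv.1.weaken h, hv.2⟩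

theorem isClosed_lipschitzCurves {O : Set E} (hO : IsOpen O) (p q : E) (K : ℝ≥0) :
    IsClosed (lipschitzCurves O p q K) := by
  have h1 : IsClosed {v : ℝ → E | LipschitzWith K v} := by
    have : {v : ℝ → E | LipschitzWith K v} = ⋂ a : ℝ, ⋂ b : ℝ, {v | dist (v a) (v b) ≤ K * dist a b} := by
      ext v
      simp [lipschitzWith_iff_dist_le_mul]
    rw [this]
    exact isClosed_iInter fun a => isClosed_iInter fun b =>
      isClosed_le ((continuous_apply a).dist (continuous_apply b)) continuous_const
  have h2 : IsClosed {v : ℝ → E | ∀ t, v t ∉ O} := by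
    have : {v : ℝ → E | ∀ t, v t ∉ O} = ⋂ t : ℝ, (fun v : ℝ → E => v t) ⁻¹' Oᶜ := by
      ext v
      simp
    rw [this]
    exact isClosed_iInter fun t => hO.isClosed_compl.preimage (continuous_apply t)
  exact h1.inter ((isClosed_eq (continuous_apply 0) continuous_const).inter
    ((isClosed_eq (continuous_apply 1) continuous_const).inter h2))

/-- Tychonoff: all the defining conditions are closed under pointwise convergence, and the Lipschitz
bound confines each value to a compact ball. -/
theorem isCompact_lipschitzCurves {O : Set E} (hO : IsOpen O) (p q : E) (K : ℝ≥0) :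
    IsCompact (lipschitzCurves O p q K) := by
  refine (isCompact_univ_pi (s := fun t : ℝ => Metric.closedBall p (K * dist t 0)) fun t =>
    isCompact_closedBall _ _).of_isClosed_subset (isClosed_lipschitzCurves hO p q K)
    fun v hv t _ => ?_
  have := hv.1.dist_le_mul t 0
  rwa [hv.2.1] at this

/-- The least Lipschitz constant is attained, by intersecting the nested compact sets for constants
decreasing to the infimum. The resulting curve minimizes the energy, because any competitor can be
reparametrized to be Lipschitz with constant squared at most its energy. -/
theorem exists_isMinimizer_of_lipschitzCurves {O : Set E} (hO : IsOpen O) {p q : E}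
    (h : ∃ K, (lipschitzCurves O p q K).Nonempty) : ∃ u, IsMinimizer O p q u := by
  let S : Set ℝ≥0 := {K | (lipschitzCurves O p q K).Nonempty}
  have hS : S.Nonempty := h
  have hSn : ∀ n : ℕ, (lipschitzCurves O p q (sInf S + 1 / (n + 1))).Nonempty := fun n => by
    obtain ⟨K, hK, hlt⟩ := exists_lt_of_csInf_lt hS
      (lt_add_of_pos_right (sInf S) (show (0 : ℝ≥0) < 1 / (n + 1) by positivity))
    exact hK.mono (lipschitzCurves_mono hlt.le)
  obtain ⟨u, hu⟩ := IsCompact.nonempty_iInter_of_sequence_nonempty_isCompact_isClosed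
    (fun n : ℕ => lipschitzCurves O p q (sInf S + 1 / (n + 1)))
    (fun n => lipschitzCurves_mono (by push_cast; gcongr; simp)) hSn
    (isCompact_lipschitzCurves hO p q _) fun n => isClosed_lipschitzCurves hO p q _
  rw [mem_iInter] at hu
  have huL : LipschitzWith (sInf S) u := by
    refine LipschitzWith.of_dist_le_mul fun a b => ?_
    have hlim : Tendsto (fun n : ℕ => ((sInf S : ℝ≥0) + 1 / ((n : ℝ) + 1)) * dist a b) atTop
        (𝓝 (((sInf S : ℝ≥0) + 0) * dist a b)) :=
      (tendsto_const_nhds.add tendsto_one_div_add_atTop_nhds_zero_nat).mul_const _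
    rw [add_zero] at hlim
    exact ge_of_tendsto' hlim fun n => by simpa using (hu n).1.dist_le_mul a b
  refine ⟨u, mem_admissible_of_mem_lipschitzCurves (hu 0), fun w hw => ?_⟩
  obtain ⟨ℓ, v, hv, hv0, hv1, hvI, hE, -⟩ := exists_lipschitz_reparam hw.1 hw.2.1
  have hℓ : ℓ ∈ S := ⟨v, hv, hv0.trans hw.2.2.1, hv1.trans hw.2.2.2.1, fun t => by
    obtain ⟨s, hs, hst⟩ := hvI t
    exact hst ▸ hw.2.2.2.2 s hs⟩
  refine (energy_le_of_lipschitz huL).trans (le_trans ?_ hE)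
  exact pow_le_pow_left₀ (by positivity) (NNReal.coe_le_coe.2 (csInf_le' hℓ)) 2

theorem lipschitzCurves_trans {O : Set E} {p q r : E} {K L : ℝ≥0} {v w : ℝ → E}
    (hv : v ∈ lipschitzCurves O p q K) (hw : w ∈ lipschitzCurves O q r L) :
    ∃ M, (lipschitzCurves O p r M).Nonempty := by
  have hmin : LipschitzWith 2 (fun t : ℝ => min (2 * t) 1) := by
    refine LipschitzWith.of_dist_le_mul fun a b => ?_
    rw [Real.dist_eq, Real.dist_eq]
    refine (abs_min_sub_min_le_max _ _ _ _).trans ?_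
    rw [← mul_sub, abs_mul]
    simp
  have hmax : LipschitzWith 2 (fun t : ℝ => max (2 * t - 1) 0) := by
    refine LipschitzWith.of_dist_le_mul fun a b => ?_
    rw [Real.dist_eq, Real.dist_eq]
    refine (abs_max_sub_max_le_max _ _ _ _).trans ?_
    rw [sub_sub_sub_cancel_right, ← mul_sub, abs_mul]
    simp
  -- Concatenation written as a sum: each half of the time interval freezes one summand, and the
  -- Lipschitz bound needs no gluing.
  refine ⟨_, fun t => v (min (2 * t) 1) + (w (max (2 * t - 1) 0) - q),
    (hv.1.comp hmin).add ((hw.1.comp hmax).sub (LipschitzWith.const q)), ?_, ?_, fun t => ?_⟩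
  · simp [hv.2.1, hw.2.1]
  · have h1 : min (2 * (1 : ℝ)) 1 = 1 := by norm_num
    have h2 : max (2 * (1 : ℝ) - 1) 0 = 1 := by norm_num
    simp only [h1, h2, hv.2.2.1, hw.2.2.1]
    abel
  · rcases le_total (2 * t) 1 with h | h
    · simpa [max_eq_right (sub_nonpos.2 h), hw.2.1] using hv.2.2.2 _
    · simpa [min_eq_right h, hv.2.2.1] using hw.2.2.2 _

theorem lipschitzCurves_segment {O : Set E} {p q : E}
    (h : ∀ t ∈ Icc (0 : ℝ) 1, AffineMap.lineMap p q t ∉ O) :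
    ∃ M, (lipschitzCurves O p q M).Nonempty := by
  refine ⟨_, fun t => AffineMap.lineMap p q (projIcc (0 : ℝ) 1 zero_le_one t : ℝ),
    (lipschitzWith_lineMap p q).comp (LipschitzWith.subtype_val _ |>.comp
      (LipschitzWith.projIcc zero_le_one)), ?_, ?_, fun t => h _ (projIcc _ _ _ t).2⟩
  · simp
  · simp

theorem lipschitzCurves_symm {O : Set E} {p q : E} {K : ℝ≥0} {v : ℝ → E}
    (hv : v ∈ lipschitzCurves O p q K) : ∃ M, (lipschitzCurves O q p M).Nonempty :=
  ⟨_, fun t => v (1 - t), hv.1.comp ((LipschitzWith.const 1).sub LipschitzWith.id),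
    by simp [hv.2.2.1], by simp [hv.2.1], fun t => hv.2.2.2 _⟩

theorem exists_norm_eq_one_inner_eq_zero (hd : 2 ≤ Module.finrank ℝ E) (x : E) :
    ∃ e : E, ‖e‖ = 1 ∧ inner ℝ x e = 0 := by
  have h1 := Submodule.finrank_add_finrank_orthogonal (ℝ ∙ x)
  have h2 : Module.finrank ℝ (ℝ ∙ x) ≤ 1 := by
    simpa using finrank_span_le_card (R := ℝ) ({x} : Set E)
  have h3 : Nontrivial (ℝ ∙ x)ᗮ := Module.nontrivial_of_finrank_pos (R := ℝ) (by omega)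
  obtain ⟨⟨e, he⟩, hne⟩ := exists_ne (0 : (ℝ ∙ x)ᗮ)
  have hne' : e ≠ 0 := fun h => hne (Subtype.ext h)
  refine ⟨‖e‖⁻¹ • e, norm_smul_inv_norm hne', ?_⟩
  rw [inner_smul_right, Submodule.mem_orthogonal_singleton_iff_inner_right.1 he, mul_zero]

/-- The straight segment works: since `⟨a, b⟩ ≥ 0`, one has `‖(1 - t) a + t b‖² ≥ 4 R² ((1 - t)² +
t²) ≥ 2 R²`. -/
theorem lipschitzCurves_of_inner_nonneg {O : Set E} {c a b : E} {R : ℝ} (hR : 0 < R)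
    (hO : O ⊆ Metric.ball c R) (ha : 2 * R ≤ ‖a‖) (hb : 2 * R ≤ ‖b‖) (hab : 0 ≤ inner ℝ a b) :
    ∃ M, (lipschitzCurves O (c + a) (c + b) M).Nonempty := by
  refine lipschitzCurves_segment fun t ht htO => ?_
  have h1 := hO htO
  have e : AffineMap.lineMap (c + a) (c + b) t - c = (1 - t) • a + t • b := by
    rw [AffineMap.lineMap_apply_module]
    module
  rw [mem_ball_iff_norm, e] at h1
  have h2 : ‖(1 - t) • a + t • b‖ ^ 2 < R ^ 2 := pow_lt_pow_left₀ h1 (norm_nonneg _) two_ne_zero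
  rw [norm_add_sq_real, norm_smul, norm_smul, inner_smul_left, inner_smul_right, mul_pow, mul_pow,
    Real.norm_eq_abs, Real.norm_eq_abs, sq_abs, sq_abs] at h2
  simp only [conj_trivial] at h2
  have h3 : (2 * R) ^ 2 ≤ ‖a‖ ^ 2 := pow_le_pow_left₀ (by positivity) ha 2
  have h4 : (2 * R) ^ 2 ≤ ‖b‖ ^ 2 := pow_le_pow_left₀ (by positivity) hb 2
  have h5 := mul_le_mul_of_nonneg_left h3 (sq_nonneg (1 - t))
  have h6 := mul_le_mul_of_nonneg_left h4 (sq_nonneg t)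
  have h7 : 0 ≤ (1 - t) * (t * inner ℝ a b) :=
    mul_nonneg (by linarith [ht.2]) (mul_nonneg ht.1 hab)
  nlinarith [mul_nonneg (sq_nonneg R) (sq_nonneg (2 * t - 1))]

/-- A point of `O` beyond `p` on the ray from `c` would put `p` into `O` by convexity. -/
theorem lipschitzCurves_radial {O : Set E} (hO : Convex ℝ O) {c p : E} (hc : c ∈ O) (hp : p ∉ O)
    {s : ℝ} (hs : 1 ≤ s) : ∃ M, (lipschitzCurves O p (c + s • (p - c)) M).Nonempty := by
  refine lipschitzCurves_segment fun t ht htO => hp ?_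
  have hr : 1 ≤ 1 + t * (s - 1) := by nlinarith [ht.1]
  have hr0 : 1 + t * (s - 1) ≠ 0 := by positivity
  have e : AffineMap.lineMap p (c + s • (p - c)) t = c + (1 + t * (s - 1)) • (p - c) := by
    rw [AffineMap.lineMap_apply_module]
    module
  rw [e] at htO
  have := hO.add_smul_sub_mem hc htO (t := (1 + t * (s - 1))⁻¹)
    ⟨by positivity, inv_le_one_of_one_le₀ hr⟩
  rwa [add_sub_cancel_left, smul_smul, inv_mul_cancel₀ hr0, one_smul, add_sub_cancel] at this

/-- Walk radially out from `p`, then by two segments through a far point in a direction orthogonal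
to `p - c`, then radially in to `q`. The dimension hypothesis provides that direction; its sign is
chosen to form no obtuse angle with `q - c`. -/
theorem exists_lipschitzCurves {O : Set E} (hd : 2 ≤ Module.finrank ℝ E) (hO : Convex ℝ O)
    (hb : Bornology.IsBounded O) (hne : O.Nonempty) {p q : E} (hp : p ∉ O) (hq : q ∉ O) :
    ∃ K, (lipschitzCurves O p q K).Nonempty := by
  obtain ⟨c, hc⟩ := hne
  obtain ⟨R, hR, hOR⟩ := hb.subset_ball_lt 0 c
  obtain ⟨e, he, hpe, hqe⟩ : ∃ e : E, ‖e‖ = 1 ∧ inner ℝ (p - c) e = 0 ∧ 0 ≤ inner ℝ e (q - c) := by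
    obtain ⟨e, he, hpe⟩ := exists_norm_eq_one_inner_eq_zero hd (p - c)
    rcases le_total 0 (inner ℝ e (q - c)) with h | h
    · exact ⟨e, he, hpe, h⟩
    · exact ⟨-e, by simpa, by simpa, by simpa⟩
  have hfar : ∀ {x : E}, x ∉ O → ∃ s : ℝ, 1 ≤ s ∧ 2 * R ≤ ‖s • (x - c)‖ := fun {x} hx => by
    have hxc : 0 < ‖x - c‖ := norm_pos_iff.2 (sub_ne_zero.2 fun h => hx (h ▸ hc))
    refine ⟨max 1 (2 * R / ‖x - c‖), le_max_left _ _, ?_⟩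
    rw [norm_smul, Real.norm_of_nonneg (by positivity), ← div_le_iff₀ hxc]
    exact le_max_right _ _
  obtain ⟨s, hs1, hs⟩ := hfar hp
  obtain ⟨r, hr1, hr⟩ := hfar hq
  have he' : 2 * R ≤ ‖(2 * R) • e‖ := by
    rw [norm_smul, he, mul_one]
    exact Real.le_norm_self _
  obtain ⟨_, v₁, h₁⟩ := lipschitzCurves_radial hO hc hp hs1
  obtain ⟨_, v₂, h₂⟩ := lipschitzCurves_of_inner_nonneg hR hOR hs he' (by
    rw [inner_smul_left, inner_smul_right, hpe]; simp)
  obtain ⟨_, v₃, h₃⟩ := lipschitzCurves_of_inner_nonneg hR hOR he' hr (by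
    rw [inner_smul_left, inner_smul_right]
    exact mul_nonneg (by simpa using hR.le) (mul_nonneg (by linarith) hqe))
  obtain ⟨_, v₄, h₄⟩ := lipschitzCurves_radial hO hc hq hr1
  obtain ⟨_, v₅, h₅⟩ := lipschitzCurves_symm h₄
  obtain ⟨_, v₆, h₆⟩ := lipschitzCurves_trans h₁ h₂
  obtain ⟨_, v₇, h₇⟩ := lipschitzCurves_trans h₆ h₃
  exact lipschitzCurves_trans h₇ h₅

end Existence

/-! ### Bounded Lipschitz functions -/

section BoundedLipschitz

variable {E F G : Type*} [NormedAddCommGroup E] [NormedSpace ℝ E] [NormedAddCommGroup F]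
  [NormedSpace ℝ F] [NormedAddCommGroup G] [NormedSpace ℝ G]

/-- A bounded Lipschitz curve. -/
def IsBoundedLipschitz (f : ℝ → E) : Prop :=
  ∃ K : ℝ≥0, LipschitzWith K f ∧ ∀ t, ‖f t‖ ≤ K

theorem isBoundedLipschitz_of_le {f : ℝ → E} {K : ℝ≥0} {C : ℝ} (hf : LipschitzWith K f)
    (hC : ∀ t, ‖f t‖ ≤ C) : IsBoundedLipschitz f :=
  ⟨max K C.toNNReal, hf.weaken (le_max_left _ _), fun t => (hC t).trans
    ((Real.le_coe_toNNReal C).trans (NNReal.coe_le_coe.2 (le_max_right _ _)))⟩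

theorem IsBoundedLipschitz.add {f g : ℝ → E} (hf : IsBoundedLipschitz f)
    (hg : IsBoundedLipschitz g) : IsBoundedLipschitz (fun t => f t + g t) := by
  obtain ⟨K, hK, hK'⟩ := hf
  obtain ⟨L, hL, hL'⟩ := hg
  exact ⟨K + L, hK.add hL, fun t => (norm_add_le _ _).trans (add_le_add (hK' t) (hL' t))⟩

theorem IsBoundedLipschitz.bilin (B : E →L[ℝ] F →L[ℝ] G) {f : ℝ → E} {g : ℝ → F}
    (hf : IsBoundedLipschitz f) (hg : IsBoundedLipschitz g) :
    IsBoundedLipschitz (fun t => B (f t) (g t)) := by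
  obtain ⟨K, hK, hK'⟩ := hf
  obtain ⟨L, hL, hL'⟩ := hg
  have hB : ∀ x y (a b : ℝ), ‖x‖ ≤ a → ‖y‖ ≤ b → ‖B x y‖ ≤ ‖B‖ * a * b := fun x y a b hx hy =>
    (B.le_opNorm₂ x y).trans (mul_le_mul (mul_le_mul_of_nonneg_left hx (norm_nonneg B)) hy
      (norm_nonneg _) (mul_nonneg (norm_nonneg B) ((norm_nonneg x).trans hx)))
  refine isBoundedLipschitz_of_le (K := ‖B‖₊ * K * L + ‖B‖₊ * K * L)
    (LipschitzWith.of_dist_le_mul fun s t => ?_) fun t => hB _ _ K L (hK' t) (hL' t)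
  have h1 := hK.dist_le_mul s t
  have h2 := hL.dist_le_mul s t
  rw [dist_eq_norm] at h1 h2 ⊢
  have e : B (f s) (g s) - B (f t) (g t) = B (f s - f t) (g s) + B (f t) (g s - g t) := by
    simp
  rw [e]
  refine (norm_add_le _ _).trans
    ((add_le_add (hB _ _ _ _ h1 (hL' s)) (hB _ _ _ _ (hK' t) h2)).trans_eq ?_)
  push_cast
  ring

theorem IsBoundedLipschitz.smul {f : ℝ → ℝ} {g : ℝ → E}
    (hf : IsBoundedLipschitz f) (hg : IsBoundedLipschitz g) :
    IsBoundedLipschitz (fun t => f t • g t) :=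
  hf.bilin (ContinuousLinearMap.lsmul ℝ ℝ) hg

theorem IsBoundedLipschitz.const (c : E) : IsBoundedLipschitz (fun _ : ℝ => c) :=
  isBoundedLipschitz_of_le (LipschitzWith.const c) fun _ => le_rfl

theorem IsBoundedLipschitz.neg {f : ℝ → E} (hf : IsBoundedLipschitz f) :
    IsBoundedLipschitz (fun t => -f t) := by
  obtain ⟨K, hK, hK'⟩ := hf
  exact ⟨K, hK.neg, fun t => by simpa using hK' t⟩

theorem IsBoundedLipschitz.posPart {f : ℝ → ℝ} (hf : IsBoundedLipschitz f) :
    IsBoundedLipschitz (fun t => max (f t) 0) := by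
  obtain ⟨K, hK, hK'⟩ := hf
  refine ⟨K, hK.max_const 0, fun t => ?_⟩
  rw [Real.norm_of_nonneg (le_max_right _ _)]
  exact max_le ((le_abs_self _).trans (hK' t)) K.2

/-- For `a` a decreasing function of `b`; it avoids a chain rule at the kink of a cutoff. -/
theorem mul_deriv_nonpos {a b : ℝ → ℝ} {a' b' t : ℝ} (ha : HasDerivAt a a' t)
    (hb : HasDerivAt b b' t) (h : ∀ s, (a s - a t) * (b s - b t) ≤ 0) : a' * b' ≤ 0 := by
  refine le_of_tendsto (ha.tendsto_slope.mul hb.tendsto_slope) (Eventually.of_forall fun s => ?_)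
  rw [slope_def_field, slope_def_field, div_mul_div_comm]
  exact div_nonpos_of_nonpos_of_nonneg (h s) (mul_self_nonneg _)

theorem intervalIntegrable_of_bounded {f : ℝ → E} {a b C : ℝ}
    (hf : AEStronglyMeasurable f (volume.restrict (uIoc a b))) (hC : ∀ t, ‖f t‖ ≤ C) :
    IntervalIntegrable f volume a b := by
  rw [intervalIntegrable_iff]
  exact IntegrableOn.of_bound (by simp [uIoc]) hf C (ae_of_all _ hC)

end BoundedLipschitz

/-! ### First variation and the weak bound on the second derivative -/

section Regularity

variable {E : Type*} [NormedAddCommGroup E] [InnerProductSpace ℝ E] [FiniteDimensional ℝ E]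

theorem IsBoundedLipschitz.inner {f g : ℝ → E} (hf : IsBoundedLipschitz f)
    (hg : IsBoundedLipschitz g) : IsBoundedLipschitz (fun t => inner ℝ (f t) (g t)) :=
  hf.bilin (innerSL ℝ) hg

/-- The constant-speed reparametrization is a competitor with energy at most `ℓ² ≤ energy u`, so
minimality gives the equality case of Cauchy–Schwarz for `u` itself. The curve `v` extends `u` by
constants outside the unit interval. -/
theorem IsMinimizer.exists_lipschitz {O : Set E} {p q : E} {u : ℝ → E} (hu : IsMinimizer O p q u) :
    ∃ (ℓ : ℝ≥0) (v : ℝ → E), v ∈ lipschitzCurves O p q ℓ ∧ EqOn u v (Icc 0 1) ∧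
      IsMinimizer O p q v ∧ energy v = (ℓ : ℝ) ^ 2 := by
  obtain ⟨hA, hmin⟩ := hu
  obtain ⟨hH, hc, h0, h1, hO⟩ := hA
  obtain ⟨ℓ, v, hv, hv0, hv1, hvI, hE, hL⟩ := exists_lipschitz_reparam hH hc
  have hvA : v ∈ lipschitzCurves O p q ℓ := ⟨hv, hv0.trans h0, hv1.trans h1, fun t => by
    obtain ⟨s, hs, hst⟩ := hvI t
    exact hst ▸ hO s hs⟩
  have huE := (hmin v (mem_admissible_of_mem_lipschitzCurves hvA)).trans
    (energy_le_of_lipschitz hv)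
  have huL := hL huE
  let U : ℝ → E := fun t => u (projIcc (0 : ℝ) 1 zero_le_one t)
  have hUu : EqOn u U (Icc 0 1) := fun t ht => by simp only [U, projIcc_of_mem _ ht]
  have hUL : LipschitzWith ℓ U := by
    have := huL.to_restrict.comp (LipschitzWith.projIcc (zero_le_one (α := ℝ)))
    rwa [mul_one] at this
  have hUA : U ∈ lipschitzCurves O p q ℓ := ⟨hUL, by rw [← hUu (by simp), h0],
    by rw [← hUu (by simp), h1], fun t => hO _ (projIcc _ _ _ t).2⟩
  have hUE : energy U = energy u :=
    (hH.isWeakDeriv_weakDeriv.congr hUu).energy_eq.trans hH.isWeakDeriv_weakDeriv.energy_eq.symm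
  exact ⟨ℓ, U, hUA, hUu, ⟨mem_admissible_of_mem_lipschitzCurves hUA,
    fun w hw => hUE.trans_le (hmin w hw)⟩, hUE.trans (le_antisymm huE hE)⟩

theorem intervalIntegrable_inner_deriv {K L : ℝ≥0} {u w : ℝ → E} (hu : LipschitzWith K u)
    (hw : LipschitzWith L w) (a b : ℝ) :
    IntervalIntegrable (fun t => inner ℝ (deriv u t) (deriv w t)) volume a b := by
  have := FiniteDimensional.complete ℝ E
  refine intervalIntegrable_of_bounded ((stronglyMeasurable_deriv u).inner
    (stronglyMeasurable_deriv w)).aestronglyMeasurable fun t => (norm_inner_le_norm _ _).trans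
      (mul_le_mul (norm_deriv_le_of_lipschitz hu) (norm_deriv_le_of_lipschitz hw)
        (norm_nonneg _) K.2)

/-- The first variation of the energy is nonnegative along one-sided admissible variations. -/
theorem IsMinimizer.first_variation {O : Set E} {p q : E} {K L : ℝ≥0} {u w : ℝ → E}
    (hu : IsMinimizer O p q u) (hK : LipschitzWith K u) (hL : LipschitzWith L w) (h0 : w 0 = 0)
    (h1 : w 1 = 0) {δ : ℝ} (hδ : 0 < δ)
    (h : ∀ ε, 0 < ε → ε ≤ δ → ∀ t, u t + ε • w t ∉ O) :
    0 ≤ ∫ t in (0 : ℝ)..1, inner ℝ (deriv u t) (deriv w t) := by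
  set A := ∫ t in (0 : ℝ)..1, inner ℝ (deriv u t) (deriv w t) with hA
  let B := ∫ t in (0 : ℝ)..1, ‖deriv w t‖ ^ 2
  have hB : 0 ≤ B := intervalIntegral.integral_nonneg zero_le_one fun _ _ => by positivity
  have isq : ∀ {M : ℝ≥0} {v : ℝ → E}, LipschitzWith M v →
      IntervalIntegrable (fun t => ‖deriv v t‖ ^ 2) volume 0 1 := fun hv => by
    simpa using intervalIntegrable_inner_deriv hv hv 0 1
  have key : ∀ ε, 0 < ε → ε ≤ δ → 0 ≤ 2 * A + ε * B := fun ε hε hεδ => by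
    have hlip : LipschitzWith (K + ‖ε‖₊ * L) (fun t => u t + ε • w t) :=
      hK.add ((lipschitzWith_smul ε).comp hL)
    have hmem : (fun t => u t + ε • w t) ∈ admissible O p q :=
      mem_admissible_of_mem_lipschitzCurves ⟨hlip, by simp [h0, hu.1.2.2.1],
        by simp [h1, hu.1.2.2.2.1], h ε hε hεδ⟩
    have hle := hu.2 _ hmem
    rw [(isWeakDeriv_deriv_of_lipschitz hK).energy_eq,
      (isWeakDeriv_deriv_of_lipschitz hlip).energy_eq] at hle
    have e : ∫ t in (0 : ℝ)..1, ‖deriv (fun t => u t + ε • w t) t‖ ^ 2 =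
        ∫ t in (0 : ℝ)..1, (‖deriv u t‖ ^ 2 + 2 * ε * inner ℝ (deriv u t) (deriv w t) +
          ε ^ 2 * ‖deriv w t‖ ^ 2) := by
      refine intervalIntegral.integral_congr_ae ?_
      filter_upwards [hK.ae_differentiableAt, hL.ae_differentiableAt] with t htu htw _
      have : HasDerivAt (fun t => u t + ε • w t) (deriv u t + ε • deriv w t) t :=
        htu.hasDerivAt.add (htw.hasDerivAt.const_smul ε)
      rw [this.deriv, norm_add_sq_real, inner_smul_right, norm_smul, mul_pow, Real.norm_eq_abs,
        sq_abs]
      ring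
    rw [e, intervalIntegral.integral_add ((isq hK).add
        ((intervalIntegrable_inner_deriv hK hL 0 1).const_mul _)) ((isq hL).const_mul _),
      intervalIntegral.integral_add (isq hK)
        ((intervalIntegrable_inner_deriv hK hL 0 1).const_mul _),
      intervalIntegral.integral_const_mul, intervalIntegral.integral_const_mul] at hle
    have : 0 ≤ ε * (2 * A + ε * B) := by
      simp only [hA, B]
      linarith
    exact nonneg_of_mul_nonneg_right this hε
  by_contra! hneg
  -- With this step the quadratic term satisfies `ε B ≤ -A`, so `2 A + ε B ≤ A < 0`; the `+ 1`
  -- guards against `B = 0`.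
  have hε : 0 < min δ (-A / (B + 1)) := lt_min hδ (div_pos (by linarith) (by linarith))
  have h2 := key _ hε (min_le_left _ _)
  have h3 : min δ (-A / (B + 1)) * B ≤ -A := by
    calc min δ (-A / (B + 1)) * B ≤ -A / (B + 1) * B :=
          mul_le_mul_of_nonneg_right (min_le_right _ _) hB
      _ ≤ -A / (B + 1) * (B + 1) := by
          refine mul_le_mul_of_nonneg_left (by linarith) (div_nonneg (by linarith) (by linarith))
      _ = -A := by field_simp
  linarith

/-- The splitting `u = x + d n` of a curve outside `O` into its projection `x` to `∂O` and its
distance `d` to `O`, where `n` is the normal of `∂O` along `x`; `κ` bounds the normal curvatures of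
`∂O` along `x`. -/
structure IsNormalSplitting (O : Set E) (κ : ℝ) (u x n : ℝ → E) (d : ℝ → ℝ) : Prop where
  lipschitz_foot : ∃ K, LipschitzWith K x
  lipschitz_normal : ∃ K, LipschitzWith K n
  lipschitz_dist : ∃ K, LipschitzWith K d
  norm_normal : ∀ t, ‖n t‖ = 1
  dist_nonneg : ∀ t, 0 ≤ d t
  eq_add : ∀ t, u t = x t + d t • n t
  notMem_of_inner_nonneg : ∀ t y, 0 ≤ inner ℝ (y - x t) (n t) → y ∉ O
  inner_le_dist : ∀ s t, inner ℝ (u s - x t) (n t) ≤ d s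
  curvature_le : ∀ t, DifferentiableAt ℝ x t → DifferentiableAt ℝ n t →
    inner ℝ (deriv x t) (deriv n t) ≤ κ * ‖deriv x t‖ ^ 2

namespace IsNormalSplitting

variable {O : Set E} {κ : ℝ} {u x n : ℝ → E} {d : ℝ → ℝ}

/-- The distance dominates the height over the supporting hyperplane at `x t`, with equality at time
`t`, so the two are tangent there. Smoothness of the distance function is not needed. -/
theorem deriv_dist (h : IsNormalSplitting O κ u x n d) {t : ℝ} (hd : DifferentiableAt ℝ d t)
    (hu : DifferentiableAt ℝ u t) : deriv d t = inner ℝ (deriv u t) (n t) := by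
  have h1 : HasDerivAt (fun s => d s - inner ℝ (u s - x t) (n t))
      (deriv d t - inner ℝ (deriv u t) (n t)) t := by
    refine hd.hasDerivAt.sub ?_
    simpa using (hu.hasDerivAt.sub_const (x t)).inner ℝ (hasDerivAt_const t (n t))
  have h2 : IsLocalMin (fun s => d s - inner ℝ (u s - x t) (n t)) t := by
    refine Eventually.of_forall fun s => ?_
    have e : d t - inner ℝ (u t - x t) (n t) = 0 := by
      rw [h.eq_add t, add_sub_cancel_left, real_inner_smul_left, real_inner_self_eq_norm_sq,
        h.norm_normal]
      ring
    simp only [e]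
    exact sub_nonneg.2 (h.inner_le_dist s t)
  exact sub_eq_zero.1 (h2.hasDerivAt_eq_zero h1)

theorem deriv_dist_eq_zero (h : IsNormalSplitting O κ u x n d) {t : ℝ} (h0 : d t = 0) :
    deriv d t = 0 :=
  IsLocalMin.deriv_eq_zero (Eventually.of_forall fun s => h0 ▸ h.dist_nonneg s)

theorem deriv_foot (h : IsNormalSplitting O κ u x n d) {t : ℝ} (hd : DifferentiableAt ℝ d t)
    (hx : DifferentiableAt ℝ x t) (hn : DifferentiableAt ℝ n t) (h0 : d t = 0) :
    deriv u t = deriv x t := by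
  have := hx.hasDerivAt.add (hd.hasDerivAt.smul hn.hasDerivAt)
  rw [h.deriv_dist_eq_zero h0, h0] at this
  rw [show u = x + d • n from funext h.eq_add, this.deriv]
  simp

/-- A minimizer has weak second derivative bounded by `|κ| ℓ²`. -/
theorem integral_inner_deriv_le (h : IsNormalSplitting O κ u x n d) {p q : E}
    (hu : IsMinimizer O p q u) {ℓ : ℝ≥0} (hℓ : LipschitzWith ℓ u) {η : ℝ → E}
    (hη : IsBoundedLipschitz η) (h0 : η 0 = 0) (h1 : η 1 = 0) :
    ∫ t in (0 : ℝ)..1, inner ℝ (deriv u t) (deriv η t) ≤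
      |κ| * ℓ ^ 2 * ∫ t in (0 : ℝ)..1, ‖η t‖ := by
  obtain ⟨Kx, hKx⟩ := h.lipschitz_foot
  obtain ⟨Kn, hKn⟩ := h.lipschitz_normal
  obtain ⟨Kd, hKd⟩ := h.lipschitz_dist
  have hn : IsBoundedLipschitz n := isBoundedLipschitz_of_le hKn fun t => (h.norm_normal t).le
  -- The variation `-η` pushes into the obstacle where `⟨η, n⟩ > 0`; adding `f n` cancels exactly
  -- this inward part.
  let f : ℝ → ℝ := fun t => max (inner ℝ (η t) (n t)) 0
  have hf : IsBoundedLipschitz f := (hη.inner hn).posPart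
  have hf0 : ∀ t, 0 ≤ f t := fun t => le_max_right _ _
  have hfη : ∀ t, f t ≤ ‖η t‖ := fun t => max_le ((real_inner_le_norm _ _).trans
    (by rw [h.norm_normal, mul_one])) (norm_nonneg _)
  obtain ⟨C, hCf, hC⟩ := hf
  -- Cutoffs decreasing to the indicator of the contact set: the correction is only needed near the
  -- obstacle.
  let θ : ℕ → ℝ → ℝ := fun k t => max (1 - (k + 1) * d t) 0
  have hθ : ∀ k, IsBoundedLipschitz (θ k) := fun k => by
    refine isBoundedLipschitz_of_le (C := 1) (((LipschitzWith.const (1 : ℝ)).sub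
      ((lipschitzWith_smul ((k : ℝ) + 1)).comp hKd)).max_const 0) fun t => ?_
    have := mul_nonneg (by positivity : (0 : ℝ) ≤ k + 1) (h.dist_nonneg t)
    rw [Real.norm_of_nonneg (le_max_right _ _)]
    exact max_le (by linarith) zero_le_one
  have hθ0 : ∀ k t, 0 ≤ θ k t := fun k t => le_max_right _ _
  have hθ1 : ∀ k t, θ k t ≤ 1 := fun k t => max_le (by
    have := mul_nonneg (by positivity : (0 : ℝ) ≤ k + 1) (h.dist_nonneg t)
    linarith) zero_le_one
  -- What remains of `⟨u', (θ f n)'⟩`, up to the factor `θ`, once `⟨u', n⟩ = d'` is used and the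
  -- term `θ' d' f ≤ 0` is dropped. On the contact set `d' = 0`, so `f'` need never be computed.
  let g : ℝ → ℝ := fun t => deriv f t * deriv d t + f t * inner ℝ (deriv u t) (deriv n t)
  have hη' := hη
  obtain ⟨Kη, hKη, -⟩ := hη
  have hgm : AEStronglyMeasurable g (volume.restrict (uIoc 0 1)) := by
    have := FiniteDimensional.complete ℝ E
    exact (((stronglyMeasurable_deriv f).mul (stronglyMeasurable_deriv d)).add
      (hCf.continuous.stronglyMeasurable.mul ((stronglyMeasurable_deriv u).inner
        (stronglyMeasurable_deriv n)))).aestronglyMeasurable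
  have hgb : ∀ t, ‖g t‖ ≤ C * Kd + C * (ℓ * Kn) := fun t => by
    refine (norm_add_le _ _).trans (add_le_add ?_ ?_)
    · rw [norm_mul]
      exact mul_le_mul (norm_deriv_le_of_lipschitz hCf) (norm_deriv_le_of_lipschitz hKd)
        (norm_nonneg _) C.2
    · rw [norm_mul]
      refine mul_le_mul (hC t) ((norm_inner_le_norm _ _).trans ?_) (norm_nonneg _) C.2
      exact mul_le_mul (norm_deriv_le_of_lipschitz hℓ) (norm_deriv_le_of_lipschitz hKn)
        (norm_nonneg _) ℓ.2
  have hθgb : ∀ k t, ‖θ k t * g t‖ ≤ C * Kd + C * (ℓ * Kn) := fun k t => by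
    rw [norm_mul, Real.norm_of_nonneg (hθ0 k t)]
    exact (mul_le_of_le_one_left (norm_nonneg _) (hθ1 k t)).trans (hgb t)
  have hθgm : ∀ k, AEStronglyMeasurable (fun t => θ k t * g t) (volume.restrict (uIoc 0 1)) :=
    fun k => by
      obtain ⟨K, hK, -⟩ := hθ k
      exact hK.continuous.aestronglyMeasurable.mul hgm
  have step : ∀ k, ∫ t in (0 : ℝ)..1, inner ℝ (deriv u t) (deriv η t) ≤
      ∫ t in (0 : ℝ)..1, θ k t * g t := fun k => by
    have hζ : IsBoundedLipschitz (fun t => (θ k t * f t) • n t) :=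
      ((hθ k).smul (⟨C, hCf, hC⟩ : IsBoundedLipschitz f)).smul hn
    have hw : IsBoundedLipschitz (fun t => (θ k t * f t) • n t + -η t) := hζ.add hη'.neg
    obtain ⟨Kθ, hKθ, -⟩ := hθ k
    obtain ⟨Kζ, hKζ, -⟩ := hζ
    obtain ⟨Kw, hKw, -⟩ := hw
    -- Since `1 - θ ≤ (k + 1) d` and `f ≤ C`, a step of at most this size lowers the height over the
    -- supporting hyperplane by no more than the available gap `d`.
    have hδ : (0 : ℝ) < 1 / ((k + 1) * (C + 1)) := by positivity
    have hvar := hu.first_variation hℓ hKw (by simp [f, h0]) (by simp [f, h1]) hδ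
      fun ε hε hεδ t => by
        refine h.notMem_of_inner_nonneg t _ ?_
        have e : inner ℝ (u t + ε • ((θ k t * f t) • n t + -η t) - x t) (n t) =
            d t + ε * (θ k t * f t - inner ℝ (η t) (n t)) := by
          have : u t + ε • ((θ k t * f t) • n t + -η t) - x t =
              d t • n t + ε • ((θ k t * f t) • n t + -η t) := by
            rw [h.eq_add t]; abel
          rw [this]
          simp only [inner_add_left, real_inner_smul_left, real_inner_self_eq_norm_sq,
            h.norm_normal, inner_neg_left]
          ring
        rw [e]
        have e1 : inner ℝ (η t) (n t) ≤ f t := le_max_left _ _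
        have e2 : 1 - (k + 1) * d t ≤ θ k t := le_max_left _ _
        have e3 : f t ≤ C := (le_abs_self _).trans (hC t)
        have e4 : (1 - θ k t) * f t ≤ ((k + 1) * d t) * (C + 1) :=
          mul_le_mul (by linarith) (by linarith) (hf0 t)
            (mul_nonneg (by positivity) (h.dist_nonneg t))
        have e5 : ε * (((k + 1) * d t) * (C + 1)) ≤ d t := by
          rw [le_div_iff₀ (by positivity)] at hεδ
          nlinarith [h.dist_nonneg t]
        have e6 : ε * (inner ℝ (η t) (n t) - θ k t * f t) ≤ ε * (((k + 1) * d t) * (C + 1)) :=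
          mul_le_mul_of_nonneg_left (by linarith) hε.le
        linarith
    have hsplit : ∫ t in (0 : ℝ)..1, inner ℝ (deriv u t)
        (deriv (fun t => (θ k t * f t) • n t + -η t) t) =
        (∫ t in (0 : ℝ)..1, inner ℝ (deriv u t) (deriv (fun t => (θ k t * f t) • n t) t)) -
        ∫ t in (0 : ℝ)..1, inner ℝ (deriv u t) (deriv η t) := by
      rw [← intervalIntegral.integral_sub (intervalIntegrable_inner_deriv hℓ hKζ 0 1)
        (intervalIntegrable_inner_deriv hℓ hKη 0 1)]
      refine intervalIntegral.integral_congr_ae ?_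
      filter_upwards [hKζ.ae_differentiableAt, hKη.ae_differentiableAt] with t ht1 ht2 _
      rw [(ht1.hasDerivAt.fun_add ht2.hasDerivAt.fun_neg).deriv, ← sub_eq_add_neg, inner_sub_right]
    rw [hsplit, sub_nonneg] at hvar
    refine hvar.trans ?_
    refine intervalIntegral.integral_mono_ae zero_le_one
      (intervalIntegrable_inner_deriv hℓ hKζ 0 1)
      (intervalIntegrable_of_bounded (hθgm k) (hθgb k)) ?_
    · filter_upwards [hKθ.ae_differentiableAt, hCf.ae_differentiableAt, hKn.ae_differentiableAt,
        hKd.ae_differentiableAt, hℓ.ae_differentiableAt] with t tθ tf tn td tu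
      have e1 : HasDerivAt (fun t => (θ k t * f t) • n t) _ t :=
        (tθ.hasDerivAt.mul tf.hasDerivAt).smul tn.hasDerivAt
      rw [e1.deriv, inner_add_right, real_inner_smul_right, real_inner_smul_right,
        ← h.deriv_dist td tu]
      have e2 : deriv (θ k) t * deriv d t ≤ 0 := by
        refine mul_deriv_nonpos tθ.hasDerivAt td.hasDerivAt fun s => ?_
        have hk : (0 : ℝ) < k + 1 := by positivity
        rcases le_total (d s) (d t) with hst | hst
        · refine mul_nonpos_of_nonneg_of_nonpos (sub_nonneg.2 (max_le_max_right _ ?_))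
            (sub_nonpos.2 hst)
          nlinarith
        · refine mul_nonpos_of_nonpos_of_nonneg (sub_nonpos.2 (max_le_max_right _ ?_))
            (sub_nonneg.2 hst)
          nlinarith
      have e3 := mul_nonneg_of_nonpos_of_nonpos e2 (neg_nonpos.2 (hf0 t))
      simp only [Pi.mul_apply, g]
      nlinarith
  -- Dominated convergence: `θ k` is 1 where `d = 0` and vanishes for large `k` where `d > 0`.
  have hlim : Tendsto (fun k => ∫ t in (0 : ℝ)..1, θ k t * g t) atTop
      (𝓝 (∫ t in (0 : ℝ)..1, indicator {t | d t = 0} g t)) := by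
    refine intervalIntegral.tendsto_integral_filter_of_dominated_convergence
      (fun _ => C * Kd + C * (ℓ * Kn)) (Eventually.of_forall hθgm)
      (Eventually.of_forall fun k => ae_of_all _ fun t _ => hθgb k t) (by simp)
      (ae_of_all _ fun t _ => ?_)
    by_cases ht : d t = 0
    · simp [ht, θ]
    · rw [indicator_of_notMem (by simpa using ht)]
      have hdt : 0 < d t := lt_of_le_of_ne (h.dist_nonneg t) (Ne.symm ht)
      obtain ⟨N, hN⟩ := exists_nat_gt (1 / d t)
      refine tendsto_const_nhds.congr' ?_
      filter_upwards [eventually_ge_atTop N] with k hk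
      have hk' : (N : ℝ) ≤ k := by exact_mod_cast hk
      rw [div_lt_iff₀ hdt] at hN
      have : θ k t = 0 := max_eq_right (by nlinarith)
      rw [this, zero_mul]
  refine (ge_of_tendsto' hlim step).trans ?_
  rw [← intervalIntegral.integral_const_mul]
  refine intervalIntegral.integral_mono_ae zero_le_one ?_
    ((hKη.continuous.norm.const_mul _).intervalIntegrable _ _) ?_
  · rw [intervalIntegrable_iff]
    exact IntegrableOn.indicator (intervalIntegrable_iff.1 (intervalIntegrable_of_bounded hgm hgb))
      (measurableSet_eq_fun hKd.continuous.measurable measurable_const)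
  · filter_upwards [hKx.ae_differentiableAt, hKn.ae_differentiableAt,
        hKd.ae_differentiableAt] with t tx tn td
    have hpos : 0 ≤ |κ| * (ℓ : ℝ) ^ 2 * ‖η t‖ := by positivity
    by_cases ht : d t = 0
    · rw [indicator_of_mem (by simpa using ht)]
      simp only [g]
      have hdx := h.deriv_foot td tx tn ht
      have hx' : ‖deriv x t‖ ^ 2 ≤ (ℓ : ℝ) ^ 2 := by
        rw [← hdx]
        exact pow_le_pow_left₀ (norm_nonneg _) (norm_deriv_le_of_lipschitz hℓ) 2
      rw [h.deriv_dist_eq_zero ht, mul_zero, zero_add, hdx, mul_comm _ ‖η t‖]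
      have h2 : inner ℝ (deriv x t) (deriv n t) ≤ |κ| * (ℓ : ℝ) ^ 2 :=
        (h.curvature_le t tx tn).trans ((mul_le_mul_of_nonneg_right (le_abs_self κ)
          (by positivity)).trans (mul_le_mul_of_nonneg_left hx' (abs_nonneg _)))
      exact (mul_le_mul_of_nonneg_left h2 (hf0 t)).trans
        (mul_le_mul_of_nonneg_right (hfη t) (by positivity))
    · rwa [indicator_of_notMem (by simpa using ht)]

end IsNormalSplitting

end Regularity

/-! ### From the weak bound to Lipschitz velocity -/

section SecondDerivative

variable {E : Type*} [NormedAddCommGroup E] [InnerProductSpace ℝ E] [FiniteDimensional ℝ E]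

/-- The ramp that is constant outside `[s, s + h]`, where it has slope `1`. -/
def ramp (s h r : ℝ) : ℝ := max 0 (min (r - s) h)

theorem isBoundedLipschitz_ramp {s h : ℝ} (hh : 0 ≤ h) : IsBoundedLipschitz (ramp s h) := by
  refine isBoundedLipschitz_of_le (K := 1) (C := h) ?_ fun t => ?_
  · have : LipschitzWith 1 fun r : ℝ => r - s := LipschitzWith.of_dist_le_mul fun a b => by simp
    exact (this.min_const h).const_max 0
  · rw [ramp, Real.norm_of_nonneg (le_max_left _ _)]
    exact max_le hh (min_le_right _ _)

theorem ae_hasDerivAt_ramp {s h : ℝ} (hh : 0 ≤ h) :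
    ∀ᵐ r, HasDerivAt (ramp s h) (indicator (Ioc s (s + h)) (fun _ => 1) r) r := by
  have h₁ : ∀ᵐ r : ℝ, r ≠ s := by simp [ae_iff, measure_singleton]
  have h₂ : ∀ᵐ r : ℝ, r ≠ s + h := by simp [ae_iff, measure_singleton]
  filter_upwards [h₁, h₂] with r hs hsh
  rcases lt_or_gt_of_ne hs with hr | hr
  · rw [indicator_of_notMem fun h' => hr.not_gt h'.1]
    refine (hasDerivAt_const r 0).congr_of_eventuallyEq ?_
    filter_upwards [gt_mem_nhds hr] with x hx
    exact max_eq_left ((min_le_left _ _).trans (by linarith))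
  · rcases lt_or_gt_of_ne hsh with hr' | hr'
    · rw [indicator_of_mem (show r ∈ Ioc s (s + h) from ⟨hr, hr'.le⟩)]
      refine ((hasDerivAt_id r).sub_const s).congr_of_eventuallyEq ?_
      filter_upwards [lt_mem_nhds hr, gt_mem_nhds hr'] with x hx hx'
      rw [ramp, min_eq_left (by linarith), max_eq_right (by linarith), id]
    · rw [indicator_of_notMem fun h' => hr'.not_ge h'.2]
      refine (hasDerivAt_const r h).congr_of_eventuallyEq ?_
      filter_upwards [lt_mem_nhds hr'] with x hx
      rw [ramp, min_eq_right (by linarith), max_eq_right hh]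

theorem integral_indicator_deriv {K : ℝ≥0} {u : ℝ → E} (hu : LipschitzWith K u) {s h : ℝ}
    (hh : 0 ≤ h) (hs : 0 ≤ s) (hsh : s + h ≤ 1) (e : E) :
    ∫ r in (0 : ℝ)..1, indicator (Ioc s (s + h)) (fun r => inner ℝ (deriv u r) e) r =
      inner ℝ (u (s + h) - u s) e := by
  have := FiniteDimensional.complete ℝ E
  rw [intervalIntegral.integral_of_le zero_le_one, setIntegral_indicator measurableSet_Ioc,
    inter_eq_self_of_subset_right (Ioc_subset_Ioc hs hsh),
    ← intervalIntegral.integral_of_le (by linarith)]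
  have h1 := (innerSL ℝ e).intervalIntegral_comp_comm
    (intervalIntegrable_deriv_of_lipschitz hu s (s + h))
  rw [integral_deriv_of_lipschitz hu] at h1
  simp only [innerSL_apply_apply] at h1
  rw [real_inner_comm, ← h1]
  exact intervalIntegral.integral_congr fun r _ => real_inner_comm _ _

/-- A Lipschitz curve whose weak second derivative is bounded by `M`, tested with trapezoids. -/
theorem inner_difference_quotient_le {K : ℝ≥0} {u : ℝ → E} (hu : LipschitzWith K u) {M : ℝ}
    (hM : 0 ≤ M)
    (hη : ∀ η : ℝ → E, IsBoundedLipschitz η → η 0 = 0 → η 1 = 0 →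
      ∫ t in (0 : ℝ)..1, inner ℝ (deriv u t) (deriv η t) ≤ M * ∫ t in (0 : ℝ)..1, ‖η t‖)
    {s t h : ℝ} (hh : 0 < h) (hs : 0 ≤ s) (hst : s ≤ t) (ht : t + h ≤ 1) (e : E) :
    inner ℝ (h⁻¹ • (u (s + h) - u s) - h⁻¹ • (u (t + h) - u t)) e ≤ M * ((t - s + h) * ‖e‖) := by
  -- A trapezoid of height at most 1 over `[s, t + h]`, with slopes `1/h` and `-1/h` on `[s, s + h]`
  -- and `[t, t + h]`: its derivative produces the two difference quotients, and its area is at most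
  -- `t - s + h`.
  let τ : ℝ → ℝ := fun r => h⁻¹ * (ramp s h r + -ramp t h r)
  have hτ : IsBoundedLipschitz τ := (IsBoundedLipschitz.const h⁻¹).smul
    ((isBoundedLipschitz_ramp hh.le).add (isBoundedLipschitz_ramp hh.le).neg)
  have hτ0 : ∀ r, 0 ≤ τ r := fun r => mul_nonneg (by positivity) (by
    have : ramp t h r ≤ ramp s h r := max_le_max_left _ (min_le_min_right _ (by linarith))
    linarith)
  have hramp1 : ∀ {a r : ℝ}, a + h ≤ r → ramp a h r = h := fun har => by
    rw [ramp, min_eq_right (by linarith), max_eq_right hh.le]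
  have hramp0 : ∀ {a r : ℝ}, r ≤ a → ramp a h r = 0 := fun har =>
    max_eq_left ((min_le_left _ _).trans (by linarith))
  have hτ1 : ∀ r, τ r ≤ indicator (Icc s (t + h)) (fun _ => 1) r := fun r => by
    by_cases hr : r ∈ Icc s (t + h)
    · rw [indicator_of_mem hr, ← inv_mul_cancel₀ hh.ne']
      refine mul_le_mul_of_nonneg_left ?_ (by positivity)
      have h1 : ramp s h r ≤ h := max_le hh.le (min_le_right _ _)
      have h2 : 0 ≤ ramp t h r := le_max_left _ _
      linarith
    · rw [indicator_of_notMem hr]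
      rcases lt_or_ge r s with h1 | h1
      · simp only [τ, hramp0 h1.le, hramp0 (h1.le.trans hst)]
        simp
      · have h2 : t + h ≤ r := le_of_not_ge fun h2 => hr ⟨h1, h2⟩
        simp only [τ, hramp1 h2, hramp1 (show s + h ≤ r by linarith)]
        simp
  have key := hη (fun r => τ r • e) (hτ.smul (IsBoundedLipschitz.const e))
    (by simp only [τ, hramp0 hs, hramp0 (hs.trans hst)]; simp)
    (by simp only [τ, hramp1 ht, hramp1 (show s + h ≤ 1 by linarith)]; simp)
  have hleft : ∫ r in (0 : ℝ)..1, inner ℝ (deriv u r) (deriv (fun r => τ r • e) r) =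
      inner ℝ (h⁻¹ • (u (s + h) - u s) - h⁻¹ • (u (t + h) - u t)) e := by
    have hi : ∀ a, IntervalIntegrable
        (indicator (Ioc a (a + h)) fun r => inner ℝ (deriv u r) e) volume 0 1 := fun a => by
      rw [intervalIntegrable_iff]
      refine IntegrableOn.indicator ?_ measurableSet_Ioc
      have := FiniteDimensional.complete ℝ E
      exact intervalIntegrable_iff.1 (intervalIntegrable_of_bounded (C := K * ‖e‖)
        ((stronglyMeasurable_deriv u).inner stronglyMeasurable_const).aestronglyMeasurable
        fun r => (norm_inner_le_norm _ _).trans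
          (mul_le_mul_of_nonneg_right (norm_deriv_le_of_lipschitz hu) (norm_nonneg _)))
    rw [inner_sub_left, real_inner_smul_left, real_inner_smul_left,
      ← integral_indicator_deriv hu hh.le hs (by linarith) e,
      ← integral_indicator_deriv hu hh.le (hs.trans hst) ht e, ← mul_sub,
      ← intervalIntegral.integral_sub (hi s) (hi t), ← intervalIntegral.integral_const_mul]
    refine intervalIntegral.integral_congr_ae ?_
    filter_upwards [ae_hasDerivAt_ramp (s := s) hh.le, ae_hasDerivAt_ramp (s := t) hh.le]
      with r h1 h2 _
    have : HasDerivAt (fun r => τ r • e) _ r := ((h1.add h2.neg).const_mul h⁻¹).smul_const e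
    rw [this.deriv, real_inner_smul_right]
    simp only [indicator]
    split_ifs <;> ring
  have hright : ∫ r in (0 : ℝ)..1, ‖τ r • e‖ ≤ (t - s + h) * ‖e‖ := by
    obtain ⟨Kτ, hKτ, -⟩ := hτ
    simp only [norm_smul, Real.norm_of_nonneg (hτ0 _)]
    rw [intervalIntegral.integral_mul_const]
    refine mul_le_mul_of_nonneg_right ?_ (norm_nonneg _)
    calc ∫ r in (0 : ℝ)..1, τ r
        ≤ ∫ r in (0 : ℝ)..1, indicator (Icc s (t + h)) (fun _ => 1) r := by
          refine intervalIntegral.integral_mono_on zero_le_one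
            (hKτ.continuous.intervalIntegrable _ _) ?_ fun r _ => hτ1 r
          rw [intervalIntegrable_iff]
          exact IntegrableOn.indicator (integrableOn_const (by simp [uIoc])) measurableSet_Icc
      _ ≤ t - s + h := by
          rw [intervalIntegral.integral_of_le zero_le_one, ← integral_Icc_eq_integral_Ioc,
            setIntegral_indicator measurableSet_Icc,
            inter_eq_self_of_subset_right (Icc_subset_Icc hs ht)]
          simp only [integral_const, MeasurableSet.univ, measureReal_restrict_apply, univ_inter,
            Real.volume_real_Icc, smul_eq_mul, mul_one]
          rw [max_eq_left (by linarith)]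
          linarith
  rw [hleft] at key
  exact key.trans (mul_le_mul_of_nonneg_left hright hM)

/-- Let `h → 0` in the trapezoid estimate and take for `e` the difference of the derivatives itself.
-/
theorem norm_deriv_sub_deriv_le {K : ℝ≥0} {u : ℝ → E} (hu : LipschitzWith K u) {M : ℝ}
    (hM : 0 ≤ M)
    (hη : ∀ η : ℝ → E, IsBoundedLipschitz η → η 0 = 0 → η 1 = 0 →
      ∫ t in (0 : ℝ)..1, inner ℝ (deriv u t) (deriv η t) ≤ M * ∫ t in (0 : ℝ)..1, ‖η t‖)
    {s t : ℝ} (hs : 0 ≤ s) (hst : s ≤ t) (ht : t < 1) (hds : DifferentiableAt ℝ u s)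
    (hdt : DifferentiableAt ℝ u t) : ‖deriv u s - deriv u t‖ ≤ M * (t - s) := by
  have key : ∀ e, inner ℝ (deriv u s - deriv u t) e ≤ M * ((t - s + 0) * ‖e‖) := fun e => by
    have hl : Tendsto (fun h : ℝ =>
        inner ℝ (h⁻¹ • (u (s + h) - u s) - h⁻¹ • (u (t + h) - u t)) e) (𝓝[>] 0)
        (𝓝 (inner ℝ (deriv u s - deriv u t) e)) :=
      (hds.hasDerivAt.tendsto_slope_zero_right.sub
        hdt.hasDerivAt.tendsto_slope_zero_right).inner tendsto_const_nhds
    have hr : Tendsto (fun h : ℝ => M * ((t - s + h) * ‖e‖)) (𝓝[>] 0)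
        (𝓝 (M * ((t - s + 0) * ‖e‖))) := by
      refine Tendsto.mono_left ?_ nhdsWithin_le_nhds
      exact Continuous.tendsto (by fun_prop) 0
    refine le_of_tendsto_of_tendsto hl hr ?_
    filter_upwards [Ioo_mem_nhdsGT (sub_pos.2 ht)] with h hh
    exact inner_difference_quotient_le hu hM hη hh.1 hs hst (by linarith [hh.2]) e
  have h1 := key (deriv u s - deriv u t)
  rw [real_inner_self_eq_norm_sq, add_zero, ← mul_assoc, sq] at h1
  by_contra! hlt
  have h2 : 0 ≤ M * (t - s) := mul_nonneg hM (by linarith)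
  exact absurd (le_of_mul_le_mul_right h1 (h2.trans_lt hlt)) hlt.not_ge

/-- A constant-speed Lipschitz curve with bounded weak second derivative is `C^{1,1}`. -/
theorem exists_velocity {ℓ : ℝ≥0} {u : ℝ → E} (hu : LipschitzWith ℓ u)
    (hE : energy u = (ℓ : ℝ) ^ 2) {M : ℝ≥0}
    (hη : ∀ η : ℝ → E, IsBoundedLipschitz η → η 0 = 0 → η 1 = 0 →
      ∫ t in (0 : ℝ)..1, inner ℝ (deriv u t) (deriv η t) ≤ M * ∫ t in (0 : ℝ)..1, ‖η t‖) :
    ∃ g : ℝ → E, Continuous g ∧ (∀ t ∈ Icc (0 : ℝ) 1, u t = u 0 + ∫ r in (0 : ℝ)..t, g r) ∧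
      (∀ t ∈ Icc (0 : ℝ) 1, ‖g t‖ = ℓ) ∧ LipschitzOnWith M g (Icc 0 1) := by
  let D : Set ℝ := {t | t ∈ Ioo (0 : ℝ) 1 ∧ DifferentiableAt ℝ u t}
  have hD : LipschitzOnWith M (deriv u) D := by
    refine LipschitzOnWith.of_dist_le_mul fun s hs t ht => ?_
    rw [dist_eq_norm, Real.dist_eq]
    rcases le_total s t with hst | hst
    · rw [abs_sub_comm, abs_of_nonneg (sub_nonneg.2 hst)]
      exact norm_deriv_sub_deriv_le hu M.2 hη hs.1.1.le hst ht.1.2 hs.2 ht.2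
    · rw [norm_sub_rev, abs_of_nonneg (sub_nonneg.2 hst)]
      exact norm_deriv_sub_deriv_le hu M.2 hη ht.1.1.le hst hs.1.2 ht.2 hs.2
  -- The extension may have a larger Lipschitz constant; it is used only for continuity, and the
  -- constant `M` on `[0, 1]` is recovered from the density of `D`.
  obtain ⟨g, hgL, hgD⟩ := hD.extend_finite_dimension
  have hgc := hgL.continuous
  have hae : ∀ᵐ t ∂(volume.restrict (Icc (0 : ℝ) 1)), deriv u t = g t ∧ t ∈ D := by
    rw [← restrict_Ioo_eq_restrict_Icc, ae_restrict_iff' measurableSet_Ioo]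
    filter_upwards [hu.ae_differentiableAt] with t ht htI using ⟨hgD ⟨htI, ht⟩, htI, ht⟩
  have hcl : Icc (0 : ℝ) 1 ⊆ closure D := by
    rw [← closure_Ioo zero_ne_one]
    refine closure_minimal (fun x hx => ?_) isClosed_closure
    rw [mem_closure_iff_nhds]
    intro t ht
    have hne : volume (t ∩ Ioo (0 : ℝ) 1) ≠ 0 :=
      (Measure.measure_pos_of_mem_nhds volume (inter_mem ht (isOpen_Ioo.mem_nhds hx))).ne'
    by_contra hem
    refine hne (measure_mono_null (fun y hy => ?_) (ae_iff.1 hu.ae_differentiableAt))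
    exact fun hdiff => hem ⟨y, hy.1, hy.2, hdiff⟩
  refine ⟨g, hgc, fun t ht => ?_, ?_, ?_⟩
  · rw [← sub_eq_iff_eq_add', ← integral_deriv_of_lipschitz hu 0 t]
    refine intervalIntegral.integral_congr_ae ?_
    rw [ae_restrict_iff' measurableSet_Icc] at hae
    filter_upwards [hae] with r hr hrt
    rw [uIoc_of_le ht.1] at hrt
    exact (hr ⟨hrt.1.le, hrt.2.trans ht.2⟩).1
  · rw [(isWeakDeriv_deriv_of_lipschitz hu).energy_eq] at hE
    have hsq : ∀ t, 0 ≤ (ℓ : ℝ) ^ 2 - ‖deriv u t‖ ^ 2 := fun t =>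
      sub_nonneg.2 (pow_le_pow_left₀ (norm_nonneg _) (norm_deriv_le_of_lipschitz hu) 2)
    have hi : IntervalIntegrable (fun t => ‖deriv u t‖ ^ 2) volume 0 1 := by
      simpa using intervalIntegrable_inner_deriv hu hu 0 1
    -- A nonnegative integrand with zero integral: the speed is `ℓ` almost everywhere, hence
    -- everywhere by continuity of `g`.
    have h0 : ∫ t in (0 : ℝ)..1, ((ℓ : ℝ) ^ 2 - ‖deriv u t‖ ^ 2) = 0 := by
      rw [intervalIntegral.integral_sub (by simp) hi, hE]
      simp
    have h1 := (intervalIntegral.integral_eq_zero_iff_of_le_of_nonneg_ae zero_le_one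
      (ae_of_all _ hsq) ((intervalIntegrable_const).sub hi)).1 h0
    rw [restrict_Ioc_eq_restrict_Icc] at h1
    refine Measure.eqOn_Icc_of_ae_eq volume zero_ne_one ?_ hgc.norm.continuousOn
      (continuousOn_const (c := (ℓ : ℝ)))
    filter_upwards [h1, hae] with t ht ht'
    rw [← ht'.1]
    have : ‖deriv u t‖ ^ 2 = (ℓ : ℝ) ^ 2 := by
      have h3 : (ℓ : ℝ) ^ 2 - ‖deriv u t‖ ^ 2 = 0 := ht
      linarith
    exact (pow_left_inj₀ (norm_nonneg _) ℓ.2 two_ne_zero).1 this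
  · have : LipschitzOnWith M g D := fun s hs t ht => by
      rw [← hgD hs, ← hgD ht]
      exact hD hs ht
    exact (this.closure hgc.continuousOn).mono hcl

/-- Regularity of minimizers along a normal splitting. -/
theorem IsMinimizer.regularity {O : Set E} {p q : E} {u : ℝ → E} (hu : IsMinimizer O p q u)
    {κ : ℝ} (h : ∀ (v : ℝ → E) (K : ℝ≥0), v ∈ lipschitzCurves O p q K →
      ∃ x n d, IsNormalSplitting O κ v x n d) :
    ContDiffOn ℝ 1 u (Icc 0 1) ∧ (p ≠ q → ∀ t ∈ Icc (0 : ℝ) 1, velocity u t ≠ 0) ∧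
      HasCurvatureAtMost u |κ| := by
  obtain ⟨ℓ, v, hv, huv, hvm, hvE⟩ := hu.exists_lipschitz
  obtain ⟨x, n, d, hs⟩ := h v ℓ hv
  obtain ⟨g, hgc, hg, hgℓ, hgL⟩ := exists_velocity hv.1 hvE (M := ‖κ‖₊ * ℓ ^ 2)
    fun η hη h0 h1 => by simpa using hs.integral_inner_deriv_le hvm hv.1 hη h0 h1
  have := FiniteDimensional.complete ℝ E
  have hU : UniqueDiffOn ℝ (Icc (0 : ℝ) 1) := uniqueDiffOn_Icc zero_lt_one
  have hd : ∀ t ∈ Icc (0 : ℝ) 1, HasDerivWithinAt u (g t) (Icc 0 1) t := fun t ht => by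
    have h1 : HasDerivAt (fun t => v 0 + ∫ r in (0 : ℝ)..t, g r) (g t) t :=
      (hgc.integral_hasStrictDerivAt 0 t).hasDerivAt.const_add _
    refine h1.hasDerivWithinAt.congr (fun s hs => ?_) ?_
    · exact (huv hs).trans (hg s hs)
    · exact (huv ht).trans (hg t ht)
  have hvel : ∀ t ∈ Icc (0 : ℝ) 1, velocity u t = g t := fun t ht =>
    (hd t ht).derivWithin (hU t ht)
  refine ⟨?_, fun hpq t ht h0 => hpq ?_, fun s hs t ht hst => ?_⟩
  · rw [contDiffOn_one_iff_derivWithin hU]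
    exact ⟨fun t ht => (hd t ht).differentiableWithinAt, hgc.continuousOn.congr hvel⟩
  · have hℓ : (ℓ : ℝ) = 0 := by rw [← hgℓ t ht, ← hvel t ht, h0, norm_zero]
    have := hv.1.dist_le_mul 0 1
    rw [hℓ, zero_mul, hv.2.1, hv.2.2.1] at this
    exact dist_le_zero.1 this
  · have hint : ∫ r in s..t, ‖velocity u r‖ = ℓ * (t - s) := by
      rw [intervalIntegral.integral_congr (g := fun _ => (ℓ : ℝ)) fun r hr => ?_]
      · simp [mul_comm]
      · rw [uIcc_of_le hst] at hr
        have hrI : r ∈ Icc (0 : ℝ) 1 := ⟨hs.1.trans hr.1, hr.2.trans ht.2⟩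
        simp only [hvel r hrI, hgℓ r hrI]
    rw [hint, unitTangent, unitTangent, hvel s hs, hvel t ht, hgℓ s hs, hgℓ t ht, ← smul_sub,
      norm_smul]
    have hle := hgL.dist_le_mul t ht s hs
    rw [dist_eq_norm, Real.dist_eq, abs_of_nonneg (sub_nonneg.2 hst)] at hle
    push_cast at hle
    rw [Real.norm_of_nonneg (by positivity)]
    -- For `ℓ = 0` the unit tangent is zero by the convention `0⁻¹ = 0`. Otherwise dividing by `ℓ`
    -- turns `|κ| ℓ² (t - s)` into `|κ|` times arc length.
    rcases eq_or_ne ℓ 0 with h0 | h0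
    · simp [h0]
    · have hpos : (0 : ℝ) < ℓ := by positivity
      rw [inv_mul_le_iff₀ hpos]
      refine hle.trans_eq ?_
      rw [Real.norm_eq_abs]
      ring

end SecondDerivative

/-! ### Outer normals, the Gauss map and the nearest-point projection -/

section Normal

variable {E : Type*} [NormedAddCommGroup E] [InnerProductSpace ℝ E] [FiniteDimensional ℝ E]
  [CompleteSpace E]

namespace IsLocalDefiningFunction

variable {O U : Set E} {x : E} {ρ : E → ℝ}

theorem contDiffAt (h : IsLocalDefiningFunction O U x ρ) : ContDiffAt ℝ ∞ ρ x :=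
  h.smooth.contDiffAt (h.isOpen.mem_nhds h.mem)

theorem mem_iff (h : IsLocalDefiningFunction O U x ρ) {y : E} (hy : y ∈ U) :
    y ∈ O ↔ ρ y < 0 := by
  have := Set.ext_iff.1 h.eq_sublevel y
  simpa [hy] using this

theorem eq_zero (h : IsLocalDefiningFunction O U x ρ) (hO : IsOpen O) (hx : x ∈ frontier O) :
    ρ x = 0 := by
  have hxO : x ∉ O := (hO.frontier_eq ▸ hx).2
  refine le_antisymm (not_lt.1 fun hpos => ?_) (not_lt.1 fun hneg => hxO ((h.mem_iff h.mem).2 hneg))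
  have hev : ∀ᶠ y in 𝓝 x, y ∈ U ∧ 0 < ρ y :=
    (h.isOpen.eventually_mem h.mem).and (h.contDiffAt.continuousAt.eventually_const_lt hpos)
  obtain ⟨y, hyO, hyU, hy⟩ := ((mem_closure_iff_frequently.1 hx.1).and_eventually hev).exists
  exact hy.not_gt ((h.mem_iff hyU).1 hyO)

theorem contDiffAt_gradient (h : IsLocalDefiningFunction O U x ρ) :
    ContDiffAt ℝ ∞ (gradient ρ) x :=
  (InnerProductSpace.toDual ℝ E).symm.contDiff.contDiffAt.comp x
    (h.contDiffAt.fderiv_right (m := ∞) (by simp))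

theorem contDiffAt_unitNormal (h : IsLocalDefiningFunction O U x ρ) :
    ContDiffAt ℝ ∞ (unitNormal ρ) x :=
  ((h.contDiffAt_gradient.norm ℝ h.regular).inv (norm_ne_zero_iff.2 h.regular)).smul
    h.contDiffAt_gradient

theorem eventually (h : IsLocalDefiningFunction O U x ρ) :
    ∀ᶠ y in 𝓝 x, IsLocalDefiningFunction O U y ρ := by
  filter_upwards [h.isOpen.mem_nhds h.mem,
    h.contDiffAt_gradient.continuousAt.eventually_ne h.regular] with y hyU hy
  exact ⟨h.isOpen, hyU, h.smooth, hy, h.eq_sublevel⟩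

theorem hasDerivAt_line (h : IsLocalDefiningFunction O U x ρ) (v : E) :
    HasDerivAt (fun t : ℝ => ρ (x + t • v)) (inner ℝ (gradient ρ x) v) 0 := by
  have h1 : HasFDerivAt ρ (fderiv ℝ ρ x) (x + (0 : ℝ) • v) := by
    simpa using (h.contDiffAt.differentiableAt (by simp)).hasFDerivAt
  have h2 : HasDerivAt (fun t : ℝ => x + t • v) v 0 := by
    simpa using ((hasDerivAt_id (0 : ℝ)).smul_const v).const_add x
  rw [inner_gradient_left]
  exact h1.comp_hasDerivAt 0 h2

theorem eventually_line_mem (h : IsLocalDefiningFunction O U x ρ) (v : E) :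
    ∀ᶠ t : ℝ in 𝓝 0, x + t • v ∈ U := by
  have : ContinuousAt (fun t : ℝ => x + t • v) 0 := by fun_prop
  exact this.eventually_mem (by simpa using h.isOpen.mem_nhds h.mem)

end IsLocalDefiningFunction

/-- `m` is a unit outer normal of the convex set `O` at `x`. -/
def IsOuterNormal (O : Set E) (x m : E) : Prop :=
  ‖m‖ = 1 ∧ ∀ y ∈ O, inner ℝ (y - x) m ≤ 0

theorem IsOuterNormal.le_of_mem_closure {O : Set E} {x m y : E} (h : IsOuterNormal O x m)
    (hy : y ∈ closure O) : inner ℝ (y - x) m ≤ 0 :=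
  closure_minimal (t := {y | inner ℝ (y - x) m ≤ 0}) h.2
    (isClosed_le (by fun_prop) continuous_const) hy

theorem IsOuterNormal.lt_of_mem {O : Set E} {x m y : E} (h : IsOuterNormal O x m)
    (hO : IsOpen O) (hy : y ∈ O) : inner ℝ (y - x) m < 0 := by
  have hc : ContinuousAt (fun t : ℝ => y + t • m) 0 := by fun_prop
  have hev : ∀ᶠ t : ℝ in 𝓝 0, y + t • m ∈ O := hc.eventually_mem (by simpa using hO.mem_nhds hy)
  obtain ⟨t, ht, ht0⟩ := ((hev.filter_mono nhdsWithin_le_nhds).and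
    (self_mem_nhdsWithin (s := Ioi (0 : ℝ)))).exists
  have := h.2 _ ht
  rw [add_sub_right_comm, inner_add_left, real_inner_smul_left, real_inner_self_eq_norm_sq,
    h.1] at this
  have ht0' : (0 : ℝ) < t := ht0
  linarith

/-- One half-space inside another: testing with the component of `m` orthogonal to `g`, pushed
slightly along `-g`, shows that this component vanishes. -/
theorem norm_smul_eq_of_inner_nonpos {g m : E} (hg : g ≠ 0)
    (h : ∀ v, inner ℝ g v < 0 → inner ℝ m v ≤ 0) : ‖m‖ • g = ‖g‖ • m := by
  have hg2 : 0 < ‖g‖ ^ 2 := by positivity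
  have hgm : 0 ≤ inner ℝ m g := by
    have := h (-g) (by rw [inner_neg_right, real_inner_self_eq_norm_sq]; linarith)
    rwa [inner_neg_right, neg_nonpos] at this
  set c := inner ℝ m g / ‖g‖ ^ 2 with hc
  have hc0 : 0 ≤ c := div_nonneg hgm hg2.le
  have horth : inner ℝ g (m - c • g) = 0 := by
    rw [inner_sub_right, real_inner_smul_right, real_inner_self_eq_norm_sq, real_inner_comm, hc]
    field_simp
    ring
  have hm : m - c • g = 0 := by
    have key : ∀ ε : ℝ, 0 < ε → ‖m - c • g‖ ^ 2 ≤ ε * inner ℝ m g := fun ε hε => by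
      have h1 := h (m - c • g - ε • g) (by
        rw [inner_sub_right, horth, real_inner_smul_right, real_inner_self_eq_norm_sq]
        nlinarith)
      have h2 : inner ℝ m (m - c • g) = ‖m - c • g‖ ^ 2 := by
        rw [← real_inner_self_eq_norm_sq, inner_sub_left m, real_inner_smul_left, horth, mul_zero,
          sub_zero]
      rw [inner_sub_right, h2, real_inner_smul_right] at h1
      linarith
    have hl : Tendsto (fun ε : ℝ => ε * inner ℝ m g) (𝓝[>] 0) (𝓝 (0 * inner ℝ m g)) :=
      (Continuous.tendsto (by fun_prop) 0).mono_left nhdsWithin_le_nhds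
    rw [zero_mul] at hl
    have := ge_of_tendsto hl (by filter_upwards [self_mem_nhdsWithin] with ε hε using key ε hε)
    simpa using le_antisymm this (by positivity)
  rw [sub_eq_zero] at hm
  rw [hm, norm_smul, Real.norm_of_nonneg hc0, smul_smul, mul_comm]

theorem IsLocalDefiningFunction.isOuterNormal {O U : Set E} {x : E} {ρ : E → ℝ}
    (h : IsLocalDefiningFunction O U x ρ) (hO : IsOpen O) (hc : Convex ℝ O)
    (hx : x ∈ frontier O) : IsOuterNormal O x (unitNormal ρ x) := by
  refine ⟨norm_smul_inv_norm h.regular, fun y hy => ?_⟩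
  rw [unitNormal, real_inner_smul_right]
  refine mul_nonpos_of_nonneg_of_nonpos (by positivity) ?_
  rw [real_inner_comm]
  refine le_of_tendsto (h.hasDerivAt_line (y - x)).tendsto_slope_zero_right ?_
  filter_upwards [(h.eventually_line_mem (y - x)).filter_mono nhdsWithin_le_nhds,
    Ioo_mem_nhdsGT (zero_lt_one' ℝ)] with t htU ht
  have hmem : x + t • (y - x) ∈ O := by
    have := hc.openSegment_closure_interior_subset_interior hx.1 (hO.interior_eq.symm ▸ hy)
    rw [hO.interior_eq] at this
    refine this ⟨1 - t, t, by linarith [ht.2], ht.1, by ring, by module⟩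
  have hneg := (h.mem_iff htU).1 hmem
  simp only [zero_add, zero_smul, add_zero, h.eq_zero hO hx, sub_zero, smul_eq_mul]
  exact mul_nonpos_of_nonneg_of_nonpos (inv_nonneg.2 ht.1.le) hneg.le

theorem IsLocalDefiningFunction.eventually_mem_of_inner_neg {O U : Set E} {x v : E} {ρ : E → ℝ}
    (h : IsLocalDefiningFunction O U x ρ) (hO : IsOpen O) (hx : x ∈ frontier O)
    (hv : inner ℝ (gradient ρ x) v < 0) : ∀ᶠ t : ℝ in 𝓝[>] 0, x + t • v ∈ O := by
  filter_upwards [(h.hasDerivAt_line v).tendsto_slope_zero_right.eventually_lt_const hv,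
    (h.eventually_line_mem v).filter_mono nhdsWithin_le_nhds, self_mem_nhdsWithin] with t h1 h2 ht
  have ht : (0 : ℝ) < t := ht
  simp only [zero_add, zero_smul, add_zero, h.eq_zero hO hx, sub_zero, smul_eq_mul] at h1
  refine (h.mem_iff h2).2 ?_
  by_contra! h3
  exact h1.not_ge (mul_nonneg (inv_nonneg.2 ht.le) h3)

/-- All directions of the open half-space `⟨∇ρ, v⟩ < 0` enter `O`, so only one supporting hyperplane
is possible. This makes the normal independent of the defining function. -/
theorem IsOuterNormal.eq_unitNormal {O U : Set E} {x m : E} {ρ : E → ℝ} (hm : IsOuterNormal O x m)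
    (h : IsLocalDefiningFunction O U x ρ) (hO : IsOpen O) (hx : x ∈ frontier O) :
    m = unitNormal ρ x := by
  have key := norm_smul_eq_of_inner_nonpos (m := m) h.regular fun v hv => by
    obtain ⟨t, h1, ht⟩ := ((h.eventually_mem_of_inner_neg hO hx hv).and
      (self_mem_nhdsWithin (s := Ioi (0 : ℝ)))).exists
    have h4 := hm.2 _ h1
    rw [add_sub_cancel_left, real_inner_smul_left, real_inner_comm] at h4
    exact nonpos_of_mul_nonpos_right h4 ht
  rw [hm.1, one_smul] at key
  have hg : ‖gradient ρ x‖ ≠ 0 := norm_ne_zero_iff.2 h.regular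
  rw [unitNormal]
  nth_rewrite 2 [key]
  rw [smul_smul, inv_mul_cancel₀ hg, one_smul]

/-- The outer unit normal of a convex set with smooth boundary. -/
noncomputable def gaussMap (O : Set E) (x : E) : E := Classical.epsilon (IsOuterNormal O x)

/-- A convex obstacle with smooth boundary. -/
structure IsObstacle (O : Set E) : Prop where
  nonempty : O.Nonempty
  isOpen : IsOpen O
  convex : Convex ℝ O
  isBounded : Bornology.IsBounded O
  smooth : HasSmoothBoundary O

namespace IsObstacle

variable {O : Set E} {x : E}

theorem isOuterNormal_gaussMap (h : IsObstacle O) (hx : x ∈ frontier O) :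
    IsOuterNormal O x (gaussMap O x) := by
  obtain ⟨U, ρ, hρ⟩ := h.smooth x hx
  exact Classical.epsilon_spec ⟨_, hρ.isOuterNormal h.isOpen h.convex hx⟩

theorem gaussMap_eq_unitNormal (h : IsObstacle O) (hx : x ∈ frontier O) {U : Set E} {ρ : E → ℝ}
    (hρ : IsLocalDefiningFunction O U x ρ) : gaussMap O x = unitNormal ρ x :=
  (h.isOuterNormal_gaussMap hx).eq_unitNormal hρ h.isOpen hx

theorem eq_gaussMap (h : IsObstacle O) (hx : x ∈ frontier O) {m : E} (hm : IsOuterNormal O x m) :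
    m = gaussMap O x := by
  obtain ⟨U, ρ, hρ⟩ := h.smooth x hx
  rw [h.gaussMap_eq_unitNormal hx hρ, hm.eq_unitNormal hρ h.isOpen hx]

theorem eventually_gaussMap_eq (h : IsObstacle O) {U : Set E} {ρ : E → ℝ}
    (hρ : IsLocalDefiningFunction O U x ρ) :
    ∀ᶠ y in 𝓝 x, y ∈ frontier O → gaussMap O y = unitNormal ρ y := by
  filter_upwards [hρ.eventually] with y hy hyO using h.gaussMap_eq_unitNormal hyO hy

theorem isCompact_frontier (h : IsObstacle O) : IsCompact (frontier O) :=
  h.isBounded.isCompact_closure.of_isClosed_subset isClosed_frontier frontier_subset_closure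

/-- Near each boundary point the Gauss map agrees on `∂O` with a smooth `unitNormal ρ`; compactness
makes the local Lipschitz bounds global. -/
theorem exists_lipschitzOnWith_gaussMap (h : IsObstacle O) :
    ∃ K, LipschitzOnWith K (gaussMap O) (frontier O) := by
  refine LocallyLipschitzOn.exists_lipschitzOnWith_of_compact h.isCompact_frontier fun x hx => ?_
  obtain ⟨U, ρ, hρ⟩ := h.smooth x hx
  obtain ⟨K, t, ht, hK⟩ := (hρ.contDiffAt_unitNormal.of_le (by simp)).exists_lipschitzOnWith
  refine ⟨K, t ∩ {y | y ∈ frontier O → gaussMap O y = unitNormal ρ y} ∩ frontier O,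
    inter_mem (mem_nhdsWithin_of_mem_nhds (inter_mem ht (h.eventually_gaussMap_eq hρ)))
      self_mem_nhdsWithin, fun y hy z hz => ?_⟩
  rw [hy.1.2 hy.2, hz.1.2 hz.2]
  exact hK hy.1.1 hz.1.1

/-! ### The nearest-point projection -/

theorem exists_projection (h : IsObstacle O) (z : E) :
    ∃ x ∈ closure O, ∀ y ∈ closure O, inner ℝ (z - x) (y - x) ≤ 0 := by
  obtain ⟨x, hx, hmin⟩ := exists_norm_eq_iInf_of_complete_convex (h.nonempty.closure)
    isClosed_closure.isComplete h.convex.closure z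
  exact ⟨x, hx, (norm_eq_iInf_iff_real_inner_le_zero h.convex.closure hx).1 hmin⟩

/-- The nearest-point projection to the closure of `O`. -/
noncomputable def proj (h : IsObstacle O) (z : E) : E := (h.exists_projection z).choose

theorem proj_mem (h : IsObstacle O) (z : E) : h.proj z ∈ closure O :=
  (h.exists_projection z).choose_spec.1

theorem inner_proj_le (h : IsObstacle O) (z : E) {y : E} (hy : y ∈ closure O) :
    inner ℝ (z - h.proj z) (y - h.proj z) ≤ 0 :=
  (h.exists_projection z).choose_spec.2 y hy

theorem lipschitzWith_proj (h : IsObstacle O) : LipschitzWith 1 h.proj := by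
  refine LipschitzWith.of_dist_le_mul fun z w => ?_
  rw [NNReal.coe_one, one_mul, dist_eq_norm, dist_eq_norm]
  have h1 := h.inner_proj_le z (h.proj_mem w)
  have h2 := h.inner_proj_le w (h.proj_mem z)
  -- Firm nonexpansiveness, the sum of the two variational inequalities.
  have h3 : ‖h.proj z - h.proj w‖ ^ 2 ≤ inner ℝ (z - w) (h.proj z - h.proj w) := by
    have e : inner ℝ (z - w) (h.proj z - h.proj w) = ‖h.proj z - h.proj w‖ ^ 2
        - inner ℝ (z - h.proj z) (h.proj w - h.proj z)
        - inner ℝ (w - h.proj w) (h.proj z - h.proj w) := by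
      rw [← real_inner_self_eq_norm_sq]
      simp only [inner_sub_left, inner_sub_right]
      ring
    linarith
  by_contra! hlt
  have h4 := h3.trans (real_inner_le_norm _ _)
  have h5 : 0 < ‖h.proj z - h.proj w‖ := (norm_nonneg _).trans_lt hlt
  nlinarith

theorem norm_sub_proj_le (h : IsObstacle O) (z : E) {y : E} (hy : y ∈ closure O) :
    ‖z - h.proj z‖ ≤ ‖z - y‖ := by
  have h1 := h.inner_proj_le z hy
  have e : ‖z - y‖ ^ 2 = ‖z - h.proj z‖ ^ 2 - 2 * inner ℝ (z - h.proj z) (y - h.proj z) +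
      ‖y - h.proj z‖ ^ 2 := by
    rw [← norm_sub_sq_real, sub_sub_sub_cancel_right]
  refine le_of_sq_le_sq ?_ (norm_nonneg _)
  nlinarith [sq_nonneg ‖y - h.proj z‖]

theorem proj_mem_frontier (h : IsObstacle O) {z : E} (hz : z ∉ O) : h.proj z ∈ frontier O := by
  rw [h.isOpen.frontier_eq]
  refine ⟨h.proj_mem z, fun hmem => ?_⟩
  have hne : z - h.proj z ≠ 0 := fun h0 => hz (sub_eq_zero.1 h0 ▸ hmem)
  have hc : ContinuousAt (fun t : ℝ => h.proj z + t • (z - h.proj z)) 0 := by fun_prop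
  have hev : ∀ᶠ t : ℝ in 𝓝 0, h.proj z + t • (z - h.proj z) ∈ O :=
    hc.eventually_mem (by simpa using h.isOpen.mem_nhds hmem)
  obtain ⟨t, ht, ht0⟩ := ((hev.filter_mono nhdsWithin_le_nhds).and
    (self_mem_nhdsWithin (s := Ioi (0 : ℝ)))).exists
  have h1 := h.inner_proj_le z (subset_closure ht)
  rw [add_sub_cancel_left, real_inner_smul_right, real_inner_self_eq_norm_sq] at h1
  have : 0 < t * ‖z - h.proj z‖ ^ 2 := mul_pos ht0 (by positivity)
  linarith

/-- The variational inequality says that the normalized `z - h.proj z` is an outer normal at the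
projection, and that normal is unique. -/
theorem sub_proj_eq (h : IsObstacle O) {z : E} (hz : z ∉ O) :
    z - h.proj z = ‖z - h.proj z‖ • gaussMap O (h.proj z) := by
  rcases eq_or_ne (z - h.proj z) 0 with h0 | h0
  · simp [h0]
  · have hn : ‖z - h.proj z‖ ≠ 0 := norm_ne_zero_iff.2 h0
    rw [← h.eq_gaussMap (h.proj_mem_frontier hz) (m := ‖z - h.proj z‖⁻¹ • (z - h.proj z))
      ⟨norm_smul_inv_norm h0, fun y hy => ?_⟩, smul_smul, mul_inv_cancel₀ hn, one_smul]
    rw [real_inner_smul_right, real_inner_comm]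
    exact mul_nonpos_of_nonneg_of_nonpos (by positivity) (h.inner_proj_le z (subset_closure hy))

end IsObstacle

end Normal

/-! ### The Weingarten map and its largest eigenvalue -/

section Curvature

variable {E : Type*} [NormedAddCommGroup E] [InnerProductSpace ℝ E] [FiniteDimensional ℝ E]
  [CompleteSpace E]

/-! ### Symmetry of the Weingarten map -/

namespace IsLocalDefiningFunction

variable {O U : Set E} {x : E} {ρ : E → ℝ}

theorem norm_unitNormal (h : IsLocalDefiningFunction O U x ρ) : ‖unitNormal ρ x‖ = 1 :=
  norm_smul_inv_norm h.regular

theorem inner_unitNormal_eq_zero_iff (h : IsLocalDefiningFunction O U x ρ) {v : E} :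
    inner ℝ (unitNormal ρ x) v = 0 ↔ inner ℝ (gradient ρ x) v = 0 := by
  have := h.regular
  simp [unitNormal, real_inner_smul_left, this]

theorem hasFDerivAt_unitNormal (h : IsLocalDefiningFunction O U x ρ) :
    HasFDerivAt (unitNormal ρ) (fderiv ℝ (unitNormal ρ) x) x :=
  (h.contDiffAt_unitNormal.differentiableAt (by simp)).hasFDerivAt

theorem inner_unitNormal_fderiv (h : IsLocalDefiningFunction O U x ρ) (v : E) :
    inner ℝ (unitNormal ρ x) (fderiv ℝ (unitNormal ρ) x v) = 0 := by
  have h1 := h.hasFDerivAt_unitNormal.inner ℝ h.hasFDerivAt_unitNormal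
  have h2 : (fun y => inner ℝ (unitNormal ρ y) (unitNormal ρ y)) =ᶠ[𝓝 x] fun _ => (1 : ℝ) := by
    filter_upwards [h.eventually] with y hy
    rw [real_inner_self_eq_norm_sq, hy.norm_unitNormal, one_pow]
  have h3 := DFunLike.congr_fun (h1.unique ((hasFDerivAt_const (1 : ℝ) x).congr_of_eventuallyEq h2)) v
  simp only [ContinuousLinearMap.comp_apply, ContinuousLinearMap.prod_apply,
    fderivInnerCLM_apply, zero_apply] at h3
  rw [real_inner_comm (unitNormal ρ x) (fderiv ℝ (unitNormal ρ) x v)] at h3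
  linarith

/-- The derivative of the factor `‖∇ρ‖⁻¹` multiplies `⟨∇ρ, w⟩ = 0`. What is left is the Hessian,
whose symmetry passes to the Weingarten map. -/
theorem inner_fderiv_unitNormal (h : IsLocalDefiningFunction O U x ρ) {v w : E}
    (hw : inner ℝ (gradient ρ x) w = 0) :
    inner ℝ (fderiv ℝ (unitNormal ρ) x v) w =
      ‖gradient ρ x‖⁻¹ * fderiv ℝ (fderiv ℝ ρ) x v w := by
  have h1 := (h.hasFDerivAt_unitNormal.inner ℝ (hasFDerivAt_const w x))
  have hr : DifferentiableAt ℝ (fun y => ‖gradient ρ y‖⁻¹) x :=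
    ((h.contDiffAt_gradient.norm ℝ h.regular).inv (norm_ne_zero_iff.2 h.regular)).differentiableAt
      (by simp)
  have hD : DifferentiableAt ℝ (fderiv ℝ ρ) x :=
    (h.contDiffAt.fderiv_right (m := ∞) (by simp)).differentiableAt (by simp)
  have h2 := hr.hasFDerivAt.mul (hD.hasFDerivAt.clm_apply (hasFDerivAt_const w x))
  have e : (fun y => inner ℝ (unitNormal ρ y) w) =
      (fun y => ‖gradient ρ y‖⁻¹) * fun y => fderiv ℝ ρ y w := by
    ext y
    rw [unitNormal, real_inner_smul_left, inner_gradient_left, Pi.mul_apply]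
  rw [e] at h1
  have h3 := DFunLike.congr_fun (h1.unique h2) v
  rw [inner_gradient_left] at hw
  simpa [hw] using h3

theorem inner_fderiv_unitNormal_symm (h : IsLocalDefiningFunction O U x ρ) {v w : E}
    (hv : inner ℝ (gradient ρ x) v = 0) (hw : inner ℝ (gradient ρ x) w = 0) :
    inner ℝ (fderiv ℝ (unitNormal ρ) x v) w = inner ℝ (fderiv ℝ (unitNormal ρ) x w) v := by
  rw [h.inner_fderiv_unitNormal hw, h.inner_fderiv_unitNormal hv,
    (h.contDiffAt.isSymmSndFDerivAt (by
      rw [minSmoothness_of_isRCLikeNormedField]; exact WithTop.coe_le_coe.2 le_top)).eq]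

/-- A maximizer of the second fundamental form on the unit tangent sphere is an eigenvector. -/
theorem fderiv_unitNormal_eq_smul (h : IsLocalDefiningFunction O U x ρ) {v : E} {κ : ℝ}
    (hv : inner ℝ (gradient ρ x) v = 0)
    (heq : inner ℝ (fderiv ℝ (unitNormal ρ) x v) v = κ * ‖v‖ ^ 2)
    (hle : ∀ w, inner ℝ (gradient ρ x) w = 0 →
      inner ℝ (fderiv ℝ (unitNormal ρ) x w) w ≤ κ * ‖w‖ ^ 2) :
    fderiv ℝ (unitNormal ρ) x v = κ • v := by
  set S := fderiv ℝ (unitNormal ρ) x with hS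
  set w := S v - κ • v with hwdef
  have hw : inner ℝ (gradient ρ x) w = 0 := by
    rw [hwdef, inner_sub_right, real_inner_smul_right, hv, mul_zero, sub_zero,
      ← h.inner_unitNormal_eq_zero_iff]
    exact h.inner_unitNormal_fderiv v
  have hsymm := h.inner_fderiv_unitNormal_symm hv hw
  rw [← hS] at hsymm
  set q := κ * ‖w‖ ^ 2 - inner ℝ (S w) w with hq
  have key : ∀ t : ℝ, 0 < t → 2 * ‖w‖ ^ 2 ≤ t * q := fun t ht => by
    -- Perturbing the maximizer in the direction of the defect `w = S v - κ v`: the first-order term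
    -- is `2 t ‖w‖²`, so `w = 0`.
    have h1 := hle (v + t • w) (by rw [inner_add_right, real_inner_smul_right, hv, hw]; simp)
    have e1 : ‖w‖ ^ 2 = inner ℝ (S v) w - κ * inner ℝ v w := by
      rw [← real_inner_self_eq_norm_sq]
      nth_rewrite 1 [hwdef]
      rw [inner_sub_left, real_inner_smul_left]
    rw [map_add, map_smul, norm_add_sq_real, norm_smul, mul_pow, Real.norm_eq_abs, sq_abs] at h1
    simp only [inner_add_left, inner_add_right, real_inner_smul_left, real_inner_smul_right] at h1
    rw [heq, ← hsymm] at h1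
    have h2 : t * (2 * ‖w‖ ^ 2) ≤ t * (t * q) := by
      rw [e1, hq]
      nlinarith
    exact le_of_mul_le_mul_left h2 ht
  have hl : Tendsto (fun t : ℝ => t * q) (𝓝[>] 0) (𝓝 (0 * q)) :=
    (Continuous.tendsto (by fun_prop) 0).mono_left nhdsWithin_le_nhds
  rw [zero_mul] at hl
  have h2 := ge_of_tendsto hl (by filter_upwards [self_mem_nhdsWithin] with t ht using key t ht)
  have h3 : w = 0 := by
    have : ‖w‖ ^ 2 = 0 := le_antisymm (by linarith) (by positivity)
    simpa using this
  exact sub_eq_zero.1 h3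

end IsLocalDefiningFunction

namespace IsObstacle

variable {O : Set E} {x : E}

theorem eventually_mem_of_inner_neg (h : IsObstacle O) (hx : x ∈ frontier O) {v : E}
    (hv : inner ℝ (gaussMap O x) v < 0) : ∀ᶠ t : ℝ in 𝓝[>] 0, x + t • v ∈ O := by
  obtain ⟨U, ρ, hρ⟩ := h.smooth x hx
  refine hρ.eventually_mem_of_inner_neg h.isOpen hx ?_
  rw [h.gaussMap_eq_unitNormal hx hρ, unitNormal, real_inner_smul_left] at hv
  exact neg_of_mul_neg_right hv (by positivity)

theorem line_notMem (h : IsObstacle O) (hx : x ∈ frontier O) {v : E}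
    (hv : inner ℝ (gaussMap O x) v = 0) (t : ℝ) : x + t • v ∉ O := fun hmem => by
  have := (h.isOuterNormal_gaussMap hx).lt_of_mem h.isOpen hmem
  rw [add_sub_cancel_left, real_inner_smul_left, real_inner_comm, hv, mul_zero] at this
  exact lt_irrefl _ this

theorem proj_eq_self (h : IsObstacle O) (hx : x ∈ closure O) : h.proj x = x := by
  have := h.norm_sub_proj_le x hx
  rw [sub_self, norm_zero] at this
  exact (sub_eq_zero.1 (norm_le_zero_iff.1 this)).symm

/-- Every tangent vector is the velocity of a curve in the boundary. -/
theorem hasDerivAt_proj_line (h : IsObstacle O) (hx : x ∈ frontier O) {v : E}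
    (hv : inner ℝ (gaussMap O x) v = 0) :
    HasDerivAt (fun t : ℝ => h.proj (x + t • v)) v 0 := by
  have hN := (h.isOuterNormal_gaussMap hx).1
  -- The tangent line stays within `o(t)` of `O`: tilting `w` inward by any `c > 0` enters `O`, at
  -- distance `c t` from the line.
  have key : ∀ {w : E}, inner ℝ (gaussMap O x) w = 0 → ∀ {c : ℝ}, 0 < c →
      ∀ᶠ t : ℝ in 𝓝[>] 0, ‖x + t • w - h.proj (x + t • w)‖ ≤ c * t := fun {w} hw c hc => by
    have hneg : inner ℝ (gaussMap O x) (w - c • gaussMap O x) < 0 := by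
      rw [inner_sub_right, hw, real_inner_smul_right, real_inner_self_eq_norm_sq, hN]
      linarith
    filter_upwards [h.eventually_mem_of_inner_neg hx hneg, self_mem_nhdsWithin] with t ht ht0
    refine (h.norm_sub_proj_le _ (subset_closure ht)).trans_eq ?_
    have e : x + t • w - (x + t • (w - c • gaussMap O x)) = (c * t) • gaussMap O x := by module
    rw [e, norm_smul, hN, mul_one, Real.norm_of_nonneg (mul_pos hc ht0).le]
  rw [hasDerivAt_iff_isLittleO_nhds_zero, Asymptotics.isLittleO_iff]
  intro c hc
  obtain ⟨a, ha, h1⟩ := mem_nhdsGT_iff_exists_Ioo_subset.1 (key hv hc)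
  obtain ⟨b, hb, h2⟩ := mem_nhdsGT_iff_exists_Ioo_subset.1
    (key (w := -v) (by rw [inner_neg_right, hv, neg_zero]) hc)
  filter_upwards [Ioo_mem_nhds (neg_lt_zero.2 (show (0 : ℝ) < b from hb)) (show (0 : ℝ) < a from ha)]
    with t ht
  have e : h.proj (x + (0 + t) • v) - h.proj (x + (0 : ℝ) • v) - t • v =
      -(x + t • v - h.proj (x + t • v)) := by
    rw [zero_add, zero_smul, add_zero, h.proj_eq_self hx.1]
    abel
  rw [e, norm_neg, Real.norm_eq_abs]
  rcases lt_trichotomy t 0 with h0 | h0 | h0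
  · have := h2 ⟨neg_pos.2 h0, by linarith [ht.1]⟩
    rw [abs_of_neg h0]
    simpa using this
  · simp [h0, h.proj_eq_self hx.1]
  · rw [abs_of_pos h0]
    exact h1 ⟨h0, ht.2⟩

theorem hasDerivAt_gaussMap_comp (h : IsObstacle O) {U : Set E} {ρ : E → ℝ} {c : ℝ → E} {t : ℝ}
    {v : E} (hρ : IsLocalDefiningFunction O U (c t) ρ) (hc : ∀ s, c s ∈ frontier O)
    (hv : HasDerivAt c v t) :
    HasDerivAt (fun s => gaussMap O (c s)) (fderiv ℝ (unitNormal ρ) (c t) v) t := by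
  refine (hρ.hasFDerivAt_unitNormal.comp_hasDerivAt t hv).congr_of_eventuallyEq ?_
  filter_upwards [hv.continuousAt.eventually (h.eventually_gaussMap_eq hρ)] with s hs using hs (hc s)

/-- The Weingarten map in terms of the Gauss map. -/
noncomputable def shape (h : IsObstacle O) (x v : E) : E :=
  deriv (fun t : ℝ => gaussMap O (h.proj (x + t • v))) 0

/-- Shows that the Weingarten map does not depend on the local defining function, so the second
fundamental form is globally defined and can be maximized over `∂O`. -/
theorem shape_eq (h : IsObstacle O) (hx : x ∈ frontier O) {U : Set E} {ρ : E → ℝ}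
    (hρ : IsLocalDefiningFunction O U x ρ) {v : E} (hv : inner ℝ (gaussMap O x) v = 0) :
    h.shape x v = fderiv ℝ (unitNormal ρ) x v := by
  have h0 : h.proj (x + (0 : ℝ) • v) = x := by simp [h.proj_eq_self hx.1]
  have := h.hasDerivAt_gaussMap_comp (c := fun t : ℝ => h.proj (x + t • v)) (t := 0)
    (by rwa [h0]) (fun s => h.proj_mem_frontier (h.line_notMem hx hv s))
    (h.hasDerivAt_proj_line hx hv)
  rw [h0] at this
  exact this.deriv

theorem inner_gaussMap_eq_zero_iff (h : IsObstacle O) (hx : x ∈ frontier O) {U : Set E}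
    {ρ : E → ℝ} (hρ : IsLocalDefiningFunction O U x ρ) {v : E} :
    inner ℝ (gaussMap O x) v = 0 ↔ inner ℝ (gradient ρ x) v = 0 := by
  rw [h.gaussMap_eq_unitNormal hx hρ, hρ.inner_unitNormal_eq_zero_iff]

/-- The unit tangent bundle of `∂O`. -/
def unitTangentBundle (O : Set E) : Set (E × E) :=
  {z ∈ frontier O ×ˢ Metric.sphere (0 : E) 1 | inner ℝ (gaussMap O z.1) z.2 = (0 : ℝ)}

theorem isCompact_unitTangentBundle (h : IsObstacle O) : IsCompact (unitTangentBundle O) := by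
  obtain ⟨K, hK⟩ := h.exists_lipschitzOnWith_gaussMap
  have hcomp := h.isCompact_frontier.prod (isCompact_sphere (0 : E) 1)
  refine hcomp.of_isClosed_subset ?_ fun z hz => hz.1
  have hcont : ContinuousOn (fun z : E × E => (inner ℝ (gaussMap O z.1) z.2 : ℝ))
      (frontier O ×ˢ Metric.sphere (0 : E) 1) :=
    (hK.continuousOn.comp continuousOn_fst fun z hz => hz.1).inner continuousOn_snd
  exact hcont.preimage_isClosed_of_isClosed hcomp.isClosed (isClosed_singleton (x := (0 : ℝ)))

theorem continuousOn_secondFundamentalForm (h : IsObstacle O) :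
    ContinuousOn (fun z : E × E => (inner ℝ (h.shape z.1 z.2) z.2 : ℝ)) (unitTangentBundle O) := by
  rintro ⟨x, v⟩ hz
  obtain ⟨U, ρ, hρ⟩ := h.smooth x hz.1.1
  have hcf : ContinuousAt (fderiv ℝ (unitNormal ρ)) x :=
    (hρ.contDiffAt_unitNormal.fderiv_right (m := ∞) (by simp)).continuousAt
  have hc : ContinuousAt (fun z : E × E => (inner ℝ (fderiv ℝ (unitNormal ρ) z.1 z.2) z.2 : ℝ))
      (x, v) :=
    ((ContinuousAt.comp (f := Prod.fst) (x := (x, v)) hcf continuousAt_fst).clm_apply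
      continuousAt_snd).inner continuousAt_snd
  refine hc.continuousWithinAt.congr_of_eventuallyEq ?_ ?_
  · filter_upwards [mem_nhdsWithin_of_mem_nhds (continuousAt_fst.eventually hρ.eventually),
      self_mem_nhdsWithin] with z hz1 hz2
    rw [h.shape_eq hz2.1.1 hz1 hz2.2]
  · rw [h.shape_eq hz.1.1 hρ hz.2]

theorem frontier_nonempty (h : IsObstacle O) [Nontrivial E] : (frontier O).Nonempty := by
  rw [nonempty_iff_ne_empty, Ne, frontier_eq_empty_iff]
  rintro (h0 | h0)
  · exact h.nonempty.ne_empty h0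
  · exact NormedSpace.unbounded_univ ℝ E (h0 ▸ h.isBounded)

theorem exists_isMaxOn_secondFundamentalForm (h : IsObstacle O) (hd : 2 ≤ Module.finrank ℝ E) :
    ∃ x₀ v₀, (x₀, v₀) ∈ unitTangentBundle O ∧ ∀ x v, (x, v) ∈ unitTangentBundle O →
      (inner ℝ (h.shape x v) v : ℝ) ≤ inner ℝ (h.shape x₀ v₀) v₀ := by
  have : Nontrivial E := Module.nontrivial_of_finrank_pos (R := ℝ) (by omega)
  obtain ⟨y, hy⟩ := h.frontier_nonempty
  obtain ⟨e, he, hye⟩ := exists_norm_eq_one_inner_eq_zero hd (gaussMap O y)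
  obtain ⟨z, hz, hmax⟩ := h.isCompact_unitTangentBundle.exists_isMaxOn
    ⟨(y, e), ⟨hy, mem_sphere_zero_iff_norm.2 he⟩, hye⟩ h.continuousOn_secondFundamentalForm
  exact ⟨z.1, z.2, hz, fun x v hxv => isMaxOn_iff.1 hmax (x, v) hxv⟩

theorem inner_fderiv_unitNormal_le (h : IsObstacle O) {κ : ℝ}
    (hκ : ∀ x v, (x, v) ∈ unitTangentBundle O → (inner ℝ (h.shape x v) v : ℝ) ≤ κ)
    (hx : x ∈ frontier O) {U : Set E} {ρ : E → ℝ} (hρ : IsLocalDefiningFunction O U x ρ) {v : E}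
    (hv : inner ℝ (gaussMap O x) v = 0) :
    inner ℝ (fderiv ℝ (unitNormal ρ) x v) v ≤ κ * ‖v‖ ^ 2 := by
  rcases eq_or_ne v 0 with rfl | hv0
  · simp
  have hn : 0 < ‖v‖ := norm_pos_iff.2 hv0
  have hv' : inner ℝ (gaussMap O x) (‖v‖⁻¹ • v) = 0 := by
    rw [real_inner_smul_right, hv, mul_zero]
  have hn1 : ‖‖v‖⁻¹ • v‖ = 1 := norm_smul_inv_norm hv0
  have h1 := hκ x (‖v‖⁻¹ • v) ⟨⟨hx, mem_sphere_zero_iff_norm.2 hn1⟩, hv'⟩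
  rw [h.shape_eq hx hρ hv', map_smul, real_inner_smul_left, real_inner_smul_right,
    ← mul_assoc, ← sq, inv_pow, inv_mul_le_iff₀ (by positivity)] at h1
  rwa [mul_comm]

/-- The principal curvatures have a maximum, which bounds the second fundamental form. -/
theorem exists_isGreatest_principalCurvatures (h : IsObstacle O) (hd : 2 ≤ Module.finrank ℝ E) :
    ∃ κ, IsGreatest (principalCurvatures O) κ ∧ ∀ x ∈ frontier O, ∀ (U : Set E) (ρ : E → ℝ),
      IsLocalDefiningFunction O U x ρ → ∀ v, inner ℝ (gaussMap O x) v = 0 →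
        inner ℝ v (fderiv ℝ (unitNormal ρ) x v) ≤ κ * ‖v‖ ^ 2 := by
  obtain ⟨x₀, v₀, hz, hmax⟩ := h.exists_isMaxOn_secondFundamentalForm hd
  refine ⟨_, ⟨?_, ?_⟩, fun x hx U ρ hρ v hv => (real_inner_comm _ _).trans_le
    (h.inner_fderiv_unitNormal_le hmax hx hρ hv)⟩
  · obtain ⟨U, ρ, hρ⟩ := h.smooth x₀ hz.1.1
    have hv1 : ‖v₀‖ = 1 := mem_sphere_zero_iff_norm.1 hz.1.2
    have hv₀ := (h.inner_gaussMap_eq_zero_iff hz.1.1 hρ).1 hz.2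
    refine ⟨x₀, hz.1.1, U, ρ, hρ, v₀, norm_ne_zero_iff.1 (by simp [hv1]), hv₀,
      hρ.fderiv_unitNormal_eq_smul hv₀ ?_ fun w hw => h.inner_fderiv_unitNormal_le hmax hz.1.1 hρ
        ((h.inner_gaussMap_eq_zero_iff hz.1.1 hρ).2 hw)⟩
    rw [h.shape_eq hz.1.1 hρ hz.2, hv1]
    ring
  · rintro k ⟨x, hx, U, ρ, hρ, v, hv0, hv, hk⟩
    have h1 := h.inner_fderiv_unitNormal_le hmax hx hρ ((h.inner_gaussMap_eq_zero_iff hx hρ).2 hv)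
    rw [hk, real_inner_smul_left, real_inner_self_eq_norm_sq] at h1
    exact le_of_mul_le_mul_right h1 (by positivity)

/-- A Lipschitz curve outside `O` splits into its projection to `∂O` and a normal part. -/
theorem isNormalSplitting (h : IsObstacle O) {κ : ℝ}
    (hκ : ∀ x ∈ frontier O, ∀ (U : Set E) (ρ : E → ℝ), IsLocalDefiningFunction O U x ρ → ∀ v,
      inner ℝ (gaussMap O x) v = 0 → inner ℝ v (fderiv ℝ (unitNormal ρ) x v) ≤ κ * ‖v‖ ^ 2)
    {p q : E} {K : ℝ≥0} {u : ℝ → E} (hu : u ∈ lipschitzCurves O p q K) :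
    IsNormalSplitting O κ u (fun t => h.proj (u t)) (fun t => gaussMap O (h.proj (u t)))
      (fun t => ‖u t - h.proj (u t)‖) := by
  have hx : ∀ t, h.proj (u t) ∈ frontier O := fun t => h.proj_mem_frontier (hu.2.2.2 t)
  have hn : ∀ t, IsOuterNormal O (h.proj (u t)) (gaussMap O (h.proj (u t))) := fun t =>
    h.isOuterNormal_gaussMap (hx t)
  have hxL := h.lipschitzWith_proj.comp hu.1
  obtain ⟨L, hL⟩ := h.exists_lipschitzOnWith_gaussMap
  refine ⟨⟨_, hxL⟩, ⟨L * (1 * K), LipschitzWith.of_dist_le_mul fun s t => ?_⟩,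
    ⟨_, lipschitzWith_one_norm.comp (hu.1.sub hxL)⟩, fun t => (hn t).1, fun t => norm_nonneg _,
    fun t => ?_, fun t y hy hyO => ?_, fun s t => ?_, fun t hdx hdn => ?_⟩
  · refine (hL.dist_le_mul _ (hx s) _ (hx t)).trans ?_
    rw [NNReal.coe_mul, mul_assoc]
    exact mul_le_mul_of_nonneg_left (hxL.dist_le_mul s t) L.2
  · rw [← h.sub_proj_eq (hu.2.2.2 t), add_sub_cancel]
  · exact ((hn t).lt_of_mem h.isOpen hyO).not_ge hy
  · have e : u s - h.proj (u t) = (u s - h.proj (u s)) + (h.proj (u s) - h.proj (u t)) := by abel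
    rw [e, inner_add_left]
    have h1 := (real_inner_le_norm (u s - h.proj (u s)) (gaussMap O (h.proj (u t))))
    rw [(hn t).1, mul_one] at h1
    linarith [(hn t).le_of_mem_closure (hx s).1]
  · obtain ⟨U, ρ, hρ⟩ := h.smooth _ (hx t)
    rw [(h.hasDerivAt_gaussMap_comp (c := fun t => h.proj (u t)) hρ hx hdx.hasDerivAt).deriv]
    refine hκ _ (hx t) U ρ hρ _ ?_
    -- The projected curve stays on one side of the supporting hyperplane that it touches at time
    -- `t`, so its velocity there is tangent to `∂O`.
    have hmax : IsLocalMax (fun s => inner ℝ (gaussMap O (h.proj (u t)))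
        (h.proj (u s) - h.proj (u t)) : ℝ → ℝ) t := by
      refine Eventually.of_forall fun s => ?_
      simp only [sub_self, inner_zero_right]
      rw [real_inner_comm]
      exact (hn t).le_of_mem_closure (hx s).1
    refine hmax.hasDerivAt_eq_zero ?_
    simpa using (hasDerivAt_const t (gaussMap O (h.proj (u t)))).inner ℝ
      (hdx.hasDerivAt.sub_const (h.proj (u t)))

end IsObstacle

end Curvature
end Obstacle

/-! ### The theorem -/

theorem theorem1p1 :
    ∃ C : ℝ → ℝ, ∀ n : ℕ, 2 ≤ n → ∀ O : Set (EuclideanSpace ℝ (Fin n)),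
      O.Nonempty → IsOpen O → Convex ℝ O → Bornology.IsBounded O →
      Obstacle.HasSmoothBoundary O →
      IsGreatest (Obstacle.principalCurvatures O) (Obstacle.maxPrincipalCurvature O) ∧
      ∀ p q : EuclideanSpace ℝ (Fin n), p ∉ closure O → q ∉ closure O →
        (∃ u, Obstacle.IsMinimizer O p q u) ∧
        ∀ u, Obstacle.IsMinimizer O p q u →
          ContDiffOn ℝ 1 u (Icc 0 1) ∧
          (p ≠ q → ∀ t ∈ Icc (0 : ℝ) 1, Obstacle.velocity u t ≠ 0) ∧
          Obstacle.HasCurvatureAtMost u (C (Obstacle.maxPrincipalCurvature O)) := by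
  -- The absolute value makes the bound nonnegative without a separate proof that convexity gives `0
  -- ≤ κ`.
  refine ⟨fun κ => |κ|, fun n hn O hne hO hc hb hs => ?_⟩
  have h : Obstacle.IsObstacle O := ⟨hne, hO, hc, hb, hs⟩
  have hd : 2 ≤ Module.finrank ℝ (EuclideanSpace ℝ (Fin n)) := by simpa using hn
  obtain ⟨κ, hκ, hbound⟩ := h.exists_isGreatest_principalCurvatures hd
  have hmax : Obstacle.maxPrincipalCurvature O = κ := hκ.csSup_eq
  refine ⟨hmax ▸ hκ, fun p q hp hq => ⟨?_, fun u hu => ?_⟩⟩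
  · exact Obstacle.exists_isMinimizer_of_lipschitzCurves hO (Obstacle.exists_lipschitzCurves hd hc
      hb hne (fun h => hp (subset_closure h)) fun h => hq (subset_closure h))
  · rw [hmax]
    exact hu.regularity fun v K hv => ⟨_, _, _, h.isNormalSplitting hbound hv⟩
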